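/- Let $(\theta_i,y_i,x_i,D_i)_{i\ge1}$ be random variables with $\theta_i,y_i,D_i\in\mathbb R$ and $x_i\in\mathbb R^p$, and let $\psi_*=(\beta_*,A_*)$. Suppose that the Fay–Herriot model is correctly specified: for every $i$, conditionally on $(x_i,D_i)$, $\theta_i\sim N(x_i^\top\beta_*,A_*)$, and conditionally on $(\theta_i,x_i,D_i)$, $y_i\sim N(\theta_i,D_i)$. Suppose further that 1. the triples $(y_i,x_i,D_i)$, $i\ge 1$, are independent and identically distributed, and there are constants $0<D_L\le D_U<\infty$ with $D_L\le D_i\le D_U$ almost surely; 2. the $x_i$ take values almost surely in a bounded subset of $\mathbb R^p$, and $E[x_ix_i^\top]$ is positive definite; 3. $\Psi\subset\mathbb R^p\times(0,\infty)$ is compact, $\psi_*\in\Psi$, and $A_*+D_L>(2\pi)^{-1}e^{-3}$. Let $\phi(\cdot;\mu,v)$ be the $N(\mu,v)$ density. For $\psi=(\beta,A)\in\Psi$, $\mu_i=x_i^\top\beta$ and $v_i=A+D_i$, put $$\mathcal D_\gamma(y_i;\psi)=\frac1\gamma\,\phi(y_i;\mu_i,v_i)^\gamma\,c_\gamma(\mu_i,v_i)\quad(0<\gamma\le1),\qquad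 \mathcal D_0(y_i;\psi)=\log\phi(y_i;\mu_i,v_i),$$ where $c_\gamma$ is either of the two normalisations $c_\gamma(\mu,v)=\{\int\phi(t;\mu,v)^{1+\gamma}dt\}^{-\gamma/(1+\gamma)}$ or $c_\gamma(\mu,v)=(2\pi v)^{\gamma^2/\{2(1+\gamma)\}}$ (which differ by a factor depending on $\gamma$ only), the same one throughout. Define the robust posterior mean and variance $$\widetilde\theta_i^{(\gamma)}(\psi)=y_i+D_i\frac{d}{dy_i}\mathcal D_\gamma(y_i;\psi),\qquad \widetilde s_i^{2(\gamma)}(\psi)=D_i+D_i^2\frac{d^2}{dy_i^2}\mathcal D_\gamma(y_i;\psi).$$ Let $\Gamma=\{\gamma_1,\dots,\gamma_M\}$ with $0=\gamma_1<\dots<\gamma_M=1$ be a fixed grid. For each number of areas $m$ and each $\gamma\in\Gamma$ let $\widehat\psi^{(\gamma)}=\widehat\psi^{(\gamma)}_m$ be, almost surely, a maximiser of $\sum_{i=1}^m\mathcal D_\gamma(y_i;\psi)$ over $\psi\in\Psi$, and let $\gamma_{op}=\gamma_{op,m}$ be, almost surely, a minimiser over $\gamma\in\Gamma$ of the total estimated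 robust posterior variance $\sum_{i=1}^m\widetilde s_i^{2(\gamma)}(\widehat\psi^{(\gamma)})$. Then $$P(\gamma_{op}=0)\to1\qquad\text{as } m\to\infty.$$ Consequently the method reduces asymptotically to the standard empirical Bayes method: writing $\widehat\psi^{(0)}=(\widehat\beta,\widehat A)$ for the maximum likelihood estimator over $\Psi$, the probability that $$\widetilde\theta_i^{(\gamma_{op})}(\widehat\psi^{(\gamma_{op})})=y_i-\frac{D_i}{\widehat A+D_i}(y_i-x_i^\top\widehat\beta)\quad\text{and}\quad \widetilde s_i^{2(\gamma_{op})}(\widehat\psi^{(\gamma_{op})})=\frac{\widehat AD_i}{\widehat A+D_i}\qquad\text{for all } i=1,\dots,m$$ tends to $1$ as $m\to\infty$. -/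

import Mathlib

open MeasureTheory ProbabilityTheory Filter Topology
open scoped NNReal ENNReal

noncomputable section

namespace FayHerriot

/-- Covariate and coefficient vectors, `ℝ^p` with its Euclidean structure. -/
abbrev Vec (p : ℕ) := EuclideanSpace ℝ (Fin p)

/-- The linear predictor `xᵀ β`. -/
def linPred {p : ℕ} (x β : Vec p) : ℝ := ∑ j, x j * β j

/-- The `N(μ, v)` density at `y`. -/
def normalDensity (μ v y : ℝ) : ℝ := gaussianPDFReal μ v.toNNReal y

/-- The normaliser `(∫ φ(t; μ, v)^(1+γ) dt)^(-γ/(1+γ))` of the `γ`-divergence. -/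
def integralNormaliser (γ μ v : ℝ) : ℝ :=
  (∫ t, normalDensity μ v t ^ (1 + γ)) ^ (-γ / (1 + γ))

/-- The closed-form weight `(2πv)^(γ²/(2(1+γ)))`; it differs from `integralNormaliser` by the
factor `(1+γ)^(γ/(2(1+γ)))`, which depends on `γ` alone. -/
def closedNormaliser (γ _μ v : ℝ) : ℝ :=
  (2 * Real.pi * v) ^ (γ ^ 2 / (2 * (1 + γ)))

/-- The generalised likelihood `𝒟_γ` of one observation `y` with marginal law `N(μ, v)`, formed
with the normaliser `c`; for `γ = 0` it is the marginal log-likelihood. -/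
def gammaLik (c : ℝ → ℝ → ℝ → ℝ) (γ μ v y : ℝ) : ℝ :=
  if γ = 0 then Real.log (normalDensity μ v y)
  else 1 / γ * normalDensity μ v y ^ γ * c γ μ v

/-- The robust posterior mean `y + D (d/dy) 𝒟_γ(y; ψ)`, where `ψ = (β, A)`. -/
def robustMean {p : ℕ} (c : ℝ → ℝ → ℝ → ℝ) (γ : ℝ) (ψ : Vec p × ℝ)
    (y : ℝ) (x : Vec p) (D : ℝ) : ℝ :=
  y + D * deriv (gammaLik c γ (linPred x ψ.1) (ψ.2 + D)) y

/-- The robust posterior variance `D + D² (d²/dy²) 𝒟_γ(y; ψ)`, where `ψ = (β, A)`. -/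
def robustVar {p : ℕ} (c : ℝ → ℝ → ℝ → ℝ) (γ : ℝ) (ψ : Vec p × ℝ)
    (y : ℝ) (x : Vec p) (D : ℝ) : ℝ :=
  D + D ^ 2 * iteratedDeriv 2 (gammaLik c γ (linPred x ψ.1) (ψ.2 + D)) y

/-- The posterior mean of `θ` given `y` in the normal model with parameter `ψ = (β, A)`. -/
def bayesMean {p : ℕ} (ψ : Vec p × ℝ) (y : ℝ) (x : Vec p) (D : ℝ) : ℝ :=
  y - D / (ψ.2 + D) * (y - linPred x ψ.1)

/-- The posterior variance of `θ` given `y` in the normal model with variance `A`. -/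
def bayesVar (A D : ℝ) : ℝ := A * D / (A + D)

section Sample

variable {Ω : Type*} {p : ℕ}

/-- The objective `∑_{i < m} 𝒟_γ(y_i; ψ)` built from the first `m` areas. -/
def objective (c : ℝ → ℝ → ℝ → ℝ) (y : ℕ → Ω → ℝ) (x : ℕ → Ω → Vec p) (D : ℕ → Ω → ℝ)
    (m : ℕ) (γ : ℝ) (ω : Ω) (ψ : Vec p × ℝ) : ℝ :=
  ∑ i ∈ Finset.range m, gammaLik c γ (linPred (x i ω) ψ.1) (ψ.2 + D i ω) (y i ω)

/-- The total robust posterior variance of the first `m` areas, at the parameter value `ψ`. -/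
def totalVar (c : ℝ → ℝ → ℝ → ℝ) (y : ℕ → Ω → ℝ) (x : ℕ → Ω → Vec p) (D : ℕ → Ω → ℝ)
    (m : ℕ) (γ : ℝ) (ω : Ω) (ψ : Vec p × ℝ) : ℝ :=
  ∑ i ∈ Finset.range m, robustVar c γ ψ (y i ω) (x i ω) (D i ω)

variable [MeasurableSpace Ω]

/-- `ψhat m γ` is, almost surely, a maximiser over `Ψ` of the objective, for every number of
areas `m` and every candidate `γ ∈ Γ`. -/
def IsRobustEstimator (P : Measure Ω) (c : ℝ → ℝ → ℝ → ℝ)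
    (y : ℕ → Ω → ℝ) (x : ℕ → Ω → Vec p) (D : ℕ → Ω → ℝ)
    (Ψ : Set (Vec p × ℝ)) (Γ : Finset ℝ) (ψhat : ℕ → ℝ → Ω → Vec p × ℝ) : Prop :=
  ∀ m, ∀ γ ∈ Γ, ∀ᵐ ω ∂P,
    ψhat m γ ω ∈ Ψ ∧ IsMaxOn (objective c y x D m γ ω) Ψ (ψhat m γ ω)

/-- `γop m` is, almost surely, a minimiser over the grid `Γ` of the total estimated robust
posterior variance, for every number of areas `m`. -/
def IsSelected (P : Measure Ω) (c : ℝ → ℝ → ℝ → ℝ)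
    (y : ℕ → Ω → ℝ) (x : ℕ → Ω → Vec p) (D : ℕ → Ω → ℝ)
    (Γ : Finset ℝ) (ψhat : ℕ → ℝ → Ω → Vec p × ℝ) (γop : ℕ → Ω → ℝ) : Prop :=
  ∀ m, ∀ᵐ ω ∂P,
    γop m ω ∈ Γ ∧ IsMinOn (fun γ => totalVar c y x D m γ ω (ψhat m γ ω)) Γ (γop m ω)

/-- The Fay–Herriot model with true parameter `ψstar = (β, A)`: conditionally on `(x_i, D_i)`,
`θ_i` is `N(x_iᵀ β, A)`, and conditionally on `(θ_i, x_i, D_i)`, `y_i` is `N(θ_i, D_i)`. -/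
structure CorrectlySpecified (P : Measure Ω) [IsFiniteMeasure P]
    (θ y : ℕ → Ω → ℝ) (x : ℕ → Ω → Vec p) (D : ℕ → Ω → ℝ) (ψstar : Vec p × ℝ) : Prop where
  measurable_θ : ∀ i, Measurable (θ i)
  law_θ : ∀ i, ∀ᵐ ω ∂P,
    condDistrib (θ i) (fun ω => (x i ω, D i ω)) P (x i ω, D i ω)
      = gaussianReal (linPred (x i ω) ψstar.1) ψstar.2.toNNReal
  law_y : ∀ i, ∀ᵐ ω ∂P,
    condDistrib (y i) (fun ω => (θ i ω, x i ω, D i ω)) P (θ i ω, x i ω, D i ω)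
      = gaussianReal (θ i ω) (D i ω).toNNReal

/-- The triples `(y_i, x_i, D_i)` are i.i.d. and `0 < D_L ≤ D_i ≤ D_U`. -/
structure SamplingCondition (P : Measure Ω)
    (y : ℕ → Ω → ℝ) (x : ℕ → Ω → Vec p) (D : ℕ → Ω → ℝ) (DL DU : ℝ) : Prop where
  measurable_y : ∀ i, Measurable (y i)
  measurable_x : ∀ i, Measurable (x i)
  measurable_D : ∀ i, Measurable (D i)
  indep : iIndepFun (fun i ω => (y i ω, x i ω, D i ω)) P
  ident : ∀ i, IdentDistrib (fun ω => (y i ω, x i ω, D i ω)) (fun ω => (y 0 ω, x 0 ω, D 0 ω)) P P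
  DL_pos : 0 < DL
  D_mem : ∀ i, ∀ᵐ ω ∂P, D i ω ∈ Set.Icc DL DU

/-- The covariates lie in a bounded set and `E[x_i x_iᵀ]` is positive definite. -/
structure CovariateCondition (P : Measure Ω) (x : ℕ → Ω → Vec p) : Prop where
  bounded : ∃ 𝒳 : Set (Vec p), Bornology.IsBounded 𝒳 ∧ ∀ i, ∀ᵐ ω ∂P, x i ω ∈ 𝒳
  posDef : ∀ i, (Matrix.of fun j k : Fin p => ∫ ω, x i ω j * x i ω k ∂P).PosDef

end Sample

/-- `Ψ ⊆ ℝ^p × (0, ∞)` is compact and contains the true parameter `ψstar = (β, A)`, and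
`A + D_L > (2π)⁻¹ e⁻³`. -/
structure ParameterCondition {p : ℕ} (Ψ : Set (Vec p × ℝ)) (ψstar : Vec p × ℝ) (DL : ℝ) :
    Prop where
  compact : IsCompact Ψ
  pos : ∀ ψ ∈ Ψ, 0 < ψ.2
  true_mem : ψstar ∈ Ψ
  lower : (2 * Real.pi)⁻¹ * Real.exp (-3) < ψstar.2 + DL

/-- A grid `0 = γ_1 < γ_2 < ⋯ < γ_M = 1`. -/
structure IsGrid (Γ : Finset ℝ) : Prop where
  zero_mem : 0 ∈ Γ
  one_mem : 1 ∈ Γ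
  subset : ∀ γ ∈ Γ, γ ∈ Set.Icc (0 : ℝ) 1

end FayHerriot

end

/-!
For each `γ` the robust likelihood is strictly proper: its expectation is uniquely maximised at the
true parameter. By the strong law in the Banach space of continuous functions on `Ψ`, averages of
continuous summands converge uniformly on `Ψ`, so almost surely every robust estimator converges to
`ψstar` and the averaged robust posterior variance at the estimator converges to its expectation at
`ψstar`. Multiplying a normal density by a power of another one gives again a multiple of a normal
density; hence the expected curvature of the `γ`-likelihood at the truth is
`-w / ((1 + γ) ^ (3 / 2) * v)` with `w` its observation-free factor, and `2 π v > e⁻³` makes it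
exceed `-1 / v`, the curvature for `γ = 0`. So `γ = 0` is the strict minimiser of the limit and is
eventually selected, almost surely; there the robust mean and variance are the Bayes ones.
-/

namespace FayHerriot

section AlmostSureLimits

lemma tendsto_measure_of_ae_eventually {Ω : Type*} [MeasurableSpace Ω] {P : Measure Ω}
    {S : ℕ → Set Ω} (h : ∀ᵐ ω ∂P, ∀ᶠ m in atTop, ω ∈ S m) :
    Tendsto (fun m => P (S m)) atTop (𝓝 (P Set.univ)) := by
  have hmono : Monotone fun n => ⋂ m ≥ n, S m := fun a b hab =>
    Set.iInter₂_mono' fun m hm => ⟨m, hab.trans hm, subset_rfl⟩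
  have hunion : P (⋃ n, ⋂ m ≥ n, S m) = P Set.univ := by
    refine measure_congr (eventuallyEq_univ.2 ?_)
    filter_upwards [h] with ω hω
    obtain ⟨n, hn⟩ := eventually_atTop.1 hω
    exact Set.mem_iUnion.2 ⟨n, Set.mem_iInter₂.2 hn⟩
  have hlim := tendsto_measure_iUnion_atTop (μ := P) hmono
  rw [hunion] at hlim
  exact tendsto_of_tendsto_of_tendsto_of_le_of_le hlim tendsto_const_nhds
    (fun n => measure_mono (Set.iInter₂_subset n le_rfl)) fun n => measure_mono (Set.subset_univ _)

lemma tendsto_argmax {ι K : Type*} [TopologicalSpace K] [CompactSpace K]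
    {l : Filter ι} {G : ι → C(K, ℝ)} {G₀ : C(K, ℝ)} (hG : Tendsto G l (𝓝 G₀))
    {a : K} (ha : ∀ b, b ≠ a → G₀ b < G₀ a) {u : ι → K} (hu : ∀ n b, G n b ≤ G n (u n)) :
    Tendsto u l (𝓝 a) := by
  refine tendsto_nhds_of_unique_mapClusterPt fun b hb => ?_
  obtain ⟨U, hUl, hub⟩ := mapClusterPt_iff_ultrafilter.1 hb
  have hGU := hG.mono_left hUl
  have hle : G₀ a ≤ G₀ b :=
    le_of_tendsto_of_tendsto' (hGU.eval tendsto_const_nhds) (hGU.eval hub) fun n => hu n a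
  by_contra hne
  exact hle.not_gt (ha b hne)

variable {Ω S K : Type*} [MeasurableSpace Ω] {P : Measure Ω}
  [TopologicalSpace S] [MeasurableSpace S] [OpensMeasurableSpace S]
  [TopologicalSpace K] [CompactSpace K] {X : ℕ → Ω → S}

lemma ae_tendsto_average_continuousMap
    (hindep : Pairwise fun i j => IndepFun (X i) (X j) P)
    (hident : ∀ i, IdentDistrib (X i) (X 0) P P)
    (F : C(S, C(K, ℝ))) (hF : Integrable (fun ω => F (X 0 ω)) P) :
    ∀ᵐ ω ∂P, Tendsto (fun n : ℕ => (n : ℝ)⁻¹ • ∑ i ∈ Finset.range n, F (X i ω)) atTop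
      (𝓝 (∫ ω, F (X 0 ω) ∂P)) := by
  let _ : MeasurableSpace C(K, ℝ) := borel _
  have : BorelSpace C(K, ℝ) := ⟨rfl⟩
  have hFm : Measurable F := F.continuous.measurable
  exact strong_law_ae (fun i ω => F (X i ω)) hF
    (fun _ _ hij => (hindep hij).comp hFm hFm) fun i => (hident i).comp hFm

lemma ae_tendsto_average_at_argmax
    (hindep : Pairwise fun i j => IndepFun (X i) (X j) P)
    (hident : ∀ i, IdentDistrib (X i) (X 0) P P) (Q V : C(S, C(K, ℝ)))
    (hQ : Integrable (fun ω => Q (X 0 ω)) P) (hV : Integrable (fun ω => V (X 0 ω)) P) {a : K}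
    (ha : ∀ b, b ≠ a → ∫ ω, Q (X 0 ω) b ∂P < ∫ ω, Q (X 0 ω) a ∂P) :
    ∀ᵐ ω ∂P, ∀ u : ℕ → K,
      (∀ n b, ∑ i ∈ Finset.range n, Q (X i ω) b ≤ ∑ i ∈ Finset.range n, Q (X i ω) (u n)) →
      Tendsto (fun n : ℕ => (n : ℝ)⁻¹ * ∑ i ∈ Finset.range n, V (X i ω) (u n)) atTop
        (𝓝 (∫ ω, V (X 0 ω) a ∂P)) := by
  simp_rw [← ContinuousMap.integral_apply hQ] at ha
  rw [← ContinuousMap.integral_apply hV]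
  filter_upwards [ae_tendsto_average_continuousMap hindep hident Q hQ,
    ae_tendsto_average_continuousMap hindep hident V hV] with ω hQω hVω u hu
  have hua : Tendsto u atTop (𝓝 a) := by
    refine tendsto_argmax hQω ha fun n b => ?_
    simp only [ContinuousMap.smul_apply, ContinuousMap.sum_apply, smul_eq_mul]
    exact mul_le_mul_of_nonneg_left (hu n b) (by positivity)
  simpa only [ContinuousMap.smul_apply, ContinuousMap.sum_apply, smul_eq_mul] using hVω.eval hua

end AlmostSureLimits

lemma eventually_argmin_eq {ι κ : Type*} {l : Filter κ} {s : Finset ι} {T : κ → ι → ℝ} {V : ι → ℝ}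
    {a : ι} (ha : a ∈ s) (hT : ∀ i ∈ s, Tendsto (fun m => T m i) l (𝓝 (V i)))
    (hV : ∀ i ∈ s, i ≠ a → V a < V i) {g : κ → ι} (hg : ∀ m, g m ∈ s)
    (hmin : ∀ m, IsMinOn (T m) s (g m)) : ∀ᶠ m in l, g m = a := by
  have hlt : ∀ᶠ m in l, ∀ i ∈ s, i ≠ a → T m a < T m i := by
    refine (eventually_all_finset s).2 fun i hi => ?_
    rcases eq_or_ne i a with rfl | hne
    · exact Eventually.of_forall fun m h => absurd rfl h
    · filter_upwards [(hT a ha).eventually_lt (hT i hi) (hV i hi hne)] with m hm _ using hm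
  filter_upwards [hlt] with m hm
  by_contra hne
  exact (hm _ (hg m) hne).not_ge (hmin m ha)

section SecondMoments

variable {Ω ι : Type*} [MeasurableSpace Ω] {P : Measure Ω} [Fintype ι] {X : Ω → ι → ℝ}

lemma dotProduct_mulVec_integral_mul (hX : ∀ j k, Integrable (fun ω => X ω j * X ω k) P)
    (v : ι → ℝ) :
    v ⬝ᵥ Matrix.mulVec (Matrix.of fun j k => ∫ ω, X ω j * X ω k ∂P) v
      = ∫ ω, (X ω ⬝ᵥ v) ^ 2 ∂P := by
  have hexpand : ∀ ω, (X ω ⬝ᵥ v) ^ 2 = ∑ j, ∑ k, v j * v k * (X ω j * X ω k) := fun ω => by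
    rw [dotProduct, sq, Finset.sum_mul_sum]
    exact Finset.sum_congr rfl fun j _ => Finset.sum_congr rfl fun k _ => by ring
  simp_rw [hexpand]
  rw [integral_finsetSum _ fun j _ => integrable_finsetSum _ fun k _ => (hX j k).const_mul _]
  simp only [dotProduct, Matrix.mulVec, Matrix.of_apply]
  refine Finset.sum_congr rfl fun j _ => ?_
  rw [integral_finsetSum _ fun k _ => (hX j k).const_mul _, Finset.mul_sum]
  refine Finset.sum_congr rfl fun k _ => ?_
  rw [integral_const_mul]
  ring

lemma eq_zero_of_ae_dotProduct_eq_zero (hX : ∀ j k, Integrable (fun ω => X ω j * X ω k) P)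
    (hpos : (Matrix.of fun j k => ∫ ω, X ω j * X ω k ∂P).PosDef) {v : ι → ℝ}
    (hv : ∀ᵐ ω ∂P, X ω ⬝ᵥ v = 0) : v = 0 := by
  by_contra hne
  have hquad := (Matrix.posDef_iff_dotProduct_mulVec.1 hpos).2 hne
  rw [star_trivial, dotProduct_mulVec_integral_mul hX,
    integral_eq_zero_of_ae (hv.mono fun ω hω => by simp [hω])] at hquad
  exact lt_irrefl _ hquad

end SecondMoments

section ConditionalLaws

variable {Ω 𝓧 𝓨 : Type*} [MeasurableSpace Ω] [MeasurableSpace 𝓧] [MeasurableSpace 𝓨]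
  {P : Measure Ω} {X : Ω → 𝓧} {Y : Ω → 𝓨} {κ : Kernel 𝓧 𝓨}

lemma hasCondDistrib_of_ae_condDistrib_eq [IsFiniteMeasure P] [StandardBorelSpace 𝓨] [Nonempty 𝓨]
    [IsFiniteKernel κ]
    (hX : AEMeasurable X P) (hY : AEMeasurable Y P)
    (h : ∀ᵐ ω ∂P, condDistrib Y X P (X ω) = κ (X ω)) : HasCondDistrib Y X κ P where
  aemeasurable := hX.prodMk hY
  map_eq := by
    ext s hs
    have hmeas (η : Kernel 𝓧 𝓨) [IsFiniteKernel η] :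
        AEMeasurable (fun z => η z (Prod.mk z ⁻¹' s)) (P.map X) :=
      (Kernel.measurable_kernel_prodMk_left hs).aemeasurable
    rw [← compProd_map_condDistrib hY, Measure.compProd_apply hs, Measure.compProd_apply hs,
      lintegral_map' (hmeas _) hX, lintegral_map' (hmeas _) hX]
    exact lintegral_congr_ae (h.mono fun ω hω => by simp only [hω])

lemma hasCondDistrib_prodMk_compProd {𝓩 : Type*} [MeasurableSpace 𝓩] {Z : Ω → 𝓩}
    {η : Kernel (𝓧 × 𝓨) 𝓩} (hY : HasCondDistrib Y X κ P)
    (hZ : HasCondDistrib Z (fun ω => (X ω, Y ω)) η P) :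
    HasCondDistrib (fun ω => (Y ω, Z ω)) X (κ ⊗ₖ η) P where
  aemeasurable := by fun_prop
  map_eq := calc
    P.map (fun ω => (X ω, Y ω, Z ω))
    _ = (P.map fun ω => ((X ω, Y ω), Z ω)).map MeasurableEquiv.prodAssoc := by
      rw [AEMeasurable.map_map_of_aemeasurable (by fun_prop) (by fun_prop)]
      rfl
    _ = (P.map X ⊗ₘ κ ⊗ₘ η).map MeasurableEquiv.prodAssoc := by rw [hZ.map_eq, hY.map_eq]
    _ = P.map X ⊗ₘ (κ ⊗ₖ η) := Measure.compProd_assoc'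

lemma integrable_compProd_of_hasCondDistrib {E : Type*} [NormedAddCommGroup E]
    (h : HasCondDistrib Y X κ P) {f : 𝓧 × 𝓨 → E} (hf : StronglyMeasurable f)
    (hint : Integrable (fun ω => f (X ω, Y ω)) P) : Integrable f (P.map X ⊗ₘ κ) := by
  rw [← h.map_eq]
  exact (integrable_map_measure hf.aestronglyMeasurable h.aemeasurable).2 hint

variable {E : Type*} [NormedAddCommGroup E] [NormedSpace ℝ E] [SFinite P] [IsSFiniteKernel κ]

lemma integrable_integral_of_hasCondDistrib (h : HasCondDistrib Y X κ P) {f : 𝓧 × 𝓨 → E}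
    (hf : StronglyMeasurable f) (hint : Integrable (fun ω => f (X ω, Y ω)) P) :
    Integrable (fun ω => ∫ t, f (X ω, t) ∂κ (X ω)) P :=
  Integrable.comp_aemeasurable (Integrable.integral_compProd (a := ())
    (κ := Kernel.const Unit (P.map X)) (η := Kernel.prodMkLeft Unit κ)
    (integrable_compProd_of_hasCondDistrib h hf hint)) h.aemeasurable_fst

lemma integral_eq_integral_integral_of_hasCondDistrib (h : HasCondDistrib Y X κ P)
    {f : 𝓧 × 𝓨 → E} (hf : StronglyMeasurable f) (hint : Integrable (fun ω => f (X ω, Y ω)) P) :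
    ∫ ω, f (X ω, Y ω) ∂P = ∫ ω, ∫ t, f (X ω, t) ∂κ (X ω) ∂P := calc
    ∫ ω, f (X ω, Y ω) ∂P = ∫ z, f z ∂(P.map fun ω => (X ω, Y ω)) :=
      (integral_map h.aemeasurable hf.aestronglyMeasurable).symm
    _ = ∫ z, ∫ t, f (z, t) ∂κ z ∂(P.map X) := by
      rw [h.map_eq, Measure.integral_compProd (integrable_compProd_of_hasCondDistrib h hf hint)]
    _ = ∫ ω, ∫ t, f (X ω, t) ∂κ (X ω) ∂P :=
      integral_map h.aemeasurable_fst hf.integral_kernel_prod_right'.aestronglyMeasurable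

lemma integral_lt_integral_of_hasCondDistrib (h : HasCondDistrib Y X κ P) {f g : 𝓧 × 𝓨 → ℝ}
    (hf : StronglyMeasurable f) (hg : StronglyMeasurable g)
    (hfint : Integrable (fun ω => f (X ω, Y ω)) P) (hgint : Integrable (fun ω => g (X ω, Y ω)) P)
    (hle : ∀ᵐ ω ∂P, ∫ t, f (X ω, t) ∂κ (X ω) ≤ ∫ t, g (X ω, t) ∂κ (X ω))
    (hlt : ∃ᵐ ω ∂P, ∫ t, f (X ω, t) ∂κ (X ω) < ∫ t, g (X ω, t) ∂κ (X ω)) :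
    ∫ ω, f (X ω, Y ω) ∂P < ∫ ω, g (X ω, Y ω) ∂P := by
  rw [integral_eq_integral_integral_of_hasCondDistrib h hf hfint,
    integral_eq_integral_integral_of_hasCondDistrib h hg hgint]
  have hfi := integrable_integral_of_hasCondDistrib h hf hfint
  have hgi := integrable_integral_of_hasCondDistrib h hg hgint
  refine (integral_mono_ae hfi hgi hle).lt_of_ne fun heq => hlt ?_
  exact ((integral_eq_iff_of_ae_le hfi hgi hle).1 heq).mono fun ω hω => hω.not_lt

end ConditionalLaws

section GaussianMoments

lemma integrable_sub_sq_gaussianReal (m : ℝ) (s : ℝ≥0) (a : ℝ) :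
    Integrable (fun t => (t - a) ^ 2) (gaussianReal m s) :=
  ((memLp_id_gaussianReal' (μ := m) (v := s) 2 (by simp)).sub (memLp_const a)).integrable_sq

lemma integral_sub_sq_gaussianReal (m : ℝ) (s : ℝ≥0) (a : ℝ) :
    ∫ t, (t - a) ^ 2 ∂(gaussianReal m s) = s + (m - a) ^ 2 := by
  have hid : MemLp (fun t : ℝ => t) 2 (gaussianReal m s) :=
    memLp_id_gaussianReal' 2 ENNReal.ofNat_ne_top
  have hvar : Var[fun t => t - a; gaussianReal m s] = s := by
    rw [variance_sub_const hid.aestronglyMeasurable, variance_fun_id_gaussianReal]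
  have hmean : ∫ t, (t - a) ∂(gaussianReal m s) = m - a := by
    rw [integral_sub (hid.integrable one_le_two) (integrable_const a), integral_id_gaussianReal]
    simp
  have hsub : MemLp (fun t => t - a) 2 (gaussianReal m s) := hid.sub (memLp_const a)
  rw [variance_eq_sub hsub, hmean] at hvar
  exact eq_add_of_sub_eq hvar

lemma lintegral_gaussianReal_gaussianReal (m : ℝ) (v w : ℝ≥0) {f : ℝ → ℝ≥0∞}
    (hf : Measurable f) :
    ∫⁻ s, ∫⁻ t, f t ∂(gaussianReal s w) ∂(gaussianReal m v)
      = ∫⁻ t, f t ∂(gaussianReal m (v + w)) := by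
  have hshift (s : ℝ) : ∫⁻ t, f t ∂(gaussianReal s w) = ∫⁻ t, f (s + t) ∂(gaussianReal 0 w) := by
    rw [← lintegral_map hf (measurable_const_add s), gaussianReal_map_const_add, zero_add]
  simp_rw [hshift]
  rw [← Measure.lintegral_conv hf, gaussianReal_conv_gaussianReal, add_zero]

end GaussianMoments

section GaussianKernel

variable {α : Type*} [MeasurableSpace α] {m : α → ℝ} {v : α → ℝ≥0}

/-- The Markov kernel `a ↦ N(m a, v a)`, for conditional laws that are normal with mean and variance
depending on the conditioning variable. -/
noncomputable def gaussianKernel (m : α → ℝ) (v : α → ℝ≥0) (hm : Measurable m)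
    (hv : Measurable v) : Kernel α ℝ where
  toFun a := gaussianReal (m a) (v a)
  measurable' := measurable_gaussianReal.comp (hm.prodMk hv)

instance (hm : Measurable m) (hv : Measurable v) : IsMarkovKernel (gaussianKernel m v hm hv) :=
  ⟨fun a => inferInstanceAs (IsProbabilityMeasure (gaussianReal (m a) (v a)))⟩

lemma snd_gaussianKernel_compProd {w : α → ℝ≥0} (hm : Measurable m) (hv : Measurable v)
    (hw : Measurable w) :
    (gaussianKernel m v hm hv ⊗ₖ
        gaussianKernel Prod.snd (fun z => w z.1) measurable_snd (hw.comp measurable_fst)).snd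
      = gaussianKernel m (fun a => v a + w a) hm (hv.add hw) := by
  ext a s hs
  rw [Kernel.snd_apply' _ _ hs, Kernel.compProd_apply (measurable_snd hs)]
  have hconv := lintegral_gaussianReal_gaussianReal (m a) (v a) (w a)
    (measurable_one.indicator hs)
  simp only [lintegral_indicator_one hs] at hconv
  exact hconv

lemma integrable_sq_of_hasCondDistrib_gaussianKernel {Ω : Type*} [MeasurableSpace Ω]
    {P : Measure Ω} [SFinite P] {X : Ω → α} {Y : Ω → ℝ} {hm : Measurable m} {hv : Measurable v}
    (h : HasCondDistrib Y X (gaussianKernel m v hm hv) P)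
    (hmX : Integrable (fun ω => m (X ω) ^ 2) P) (hvX : Integrable (fun ω => (v (X ω) : ℝ)) P) :
    Integrable (fun ω => Y ω ^ 2) P := by
  have hmeas : Measurable fun z : α × ℝ => z.2 ^ 2 := by fun_prop
  have hsq (a : α) : Integrable (fun t => t ^ 2) (gaussianReal (m a) (v a)) := by
    simpa only [sub_zero] using integrable_sub_sq_gaussianReal (m a) (v a) 0
  have hmoment (a : α) : ∫ t, t ^ 2 ∂(gaussianReal (m a) (v a)) = v a + m a ^ 2 := by
    simpa only [sub_zero] using integral_sub_sq_gaussianReal (m a) (v a) 0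
  have hcomp : Integrable (fun z : α × ℝ => z.2 ^ 2) (P.map X ⊗ₘ gaussianKernel m v hm hv) := by
    refine (Measure.integrable_compProd_iff hmeas.aestronglyMeasurable).2
      ⟨Eventually.of_forall fun a => hsq a, ?_⟩
    simp only [norm_pow, Real.norm_eq_abs, sq_abs]
    refine Integrable.congr (f := fun a => (v a : ℝ) + m a ^ 2) ?_
      (Eventually.of_forall fun a => (hmoment a).symm)
    exact (integrable_map_measure (by fun_prop) h.aemeasurable_fst).2 (hvX.add hmX)
  rw [← h.map_eq] at hcomp
  exact (integrable_map_measure hmeas.aestronglyMeasurable h.aemeasurable).1 hcomp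

end GaussianKernel

section MarginalModel

variable {Ω : Type*} [MeasurableSpace Ω] {P : Measure Ω} {p : ℕ}

@[fun_prop]
lemma continuous_linPred : Continuous fun z : Vec p × Vec p => linPred z.1 z.2 := by
  unfold linPred
  fun_prop

/-- The law `N(xᵀ β, A + D)` of an observation given its covariate and sampling variance `(x, D)`,
where `ψ = (β, A)`; negative variances are truncated to zero. -/
noncomputable def marginalKernel (ψ : Vec p × ℝ) : Kernel (Vec p × ℝ) ℝ :=
  gaussianKernel (fun s => linPred s.1 ψ.1) (fun s => ψ.2.toNNReal + s.2.toNNReal)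
    (continuous_linPred.measurable.comp (by fun_prop : Measurable fun s : Vec p × ℝ => (s.1, ψ.1)))
    (by fun_prop)

instance (ψ : Vec p × ℝ) : IsMarkovKernel (marginalKernel ψ) := by
  unfold marginalKernel
  infer_instance

lemma CorrectlySpecified.hasCondDistrib [IsFiniteMeasure P] {θ y : ℕ → Ω → ℝ}
    {x : ℕ → Ω → Vec p} {D : ℕ → Ω → ℝ} {ψ : Vec p × ℝ} (h : CorrectlySpecified P θ y x D ψ)
    {i : ℕ} (hy : Measurable (y i)) (hx : Measurable (x i)) (hD : Measurable (D i)) :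
    HasCondDistrib (y i) (fun ω => (x i ω, D i ω)) (marginalKernel ψ) P := by
  have hθ := h.measurable_θ i
  have hlin : Measurable fun s : Vec p × ℝ => linPred s.1 ψ.1 :=
    continuous_linPred.measurable.comp (by fun_prop : Measurable fun s : Vec p × ℝ => (s.1, ψ.1))
  have hlatent : HasCondDistrib (θ i) (fun ω => (x i ω, D i ω))
      (gaussianKernel (fun s => linPred s.1 ψ.1) (fun _ => ψ.2.toNNReal) hlin measurable_const) P :=
    hasCondDistrib_of_ae_condDistrib_eq (by fun_prop) (by fun_prop) (h.law_θ i)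
  let κ : Kernel ((Vec p × ℝ) × ℝ) ℝ :=
    gaussianKernel Prod.snd (fun z => z.1.2.toNNReal) measurable_snd (by fun_prop)
  have hobs : HasCondDistrib (y i) (fun ω => ((x i ω, D i ω), θ i ω)) κ P :=
    HasCondDistrib.comp_right (f := Prod.swap) (hf := measurable_swap)
      (Z := fun ω => (θ i ω, x i ω, D i ω))
      (hasCondDistrib_of_ae_condDistrib_eq (by fun_prop) (by fun_prop) (h.law_y i))
  have hmarginal := (hasCondDistrib_prodMk_compProd hlatent hobs).snd
  rwa [snd_gaussianKernel_compProd (w := fun s : Vec p × ℝ => s.2.toNNReal) hlin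
    measurable_const (by fun_prop)] at hmarginal

/-- The marginal model of a single area, without its latent effect `θ`: a normal observation `y`
given `(x, D)`, with bounded covariate and with sampling variance between `DL > 0` and `DU`. -/
structure MarginalModel (P : Measure Ω) (y : Ω → ℝ) (x : Ω → Vec p) (D : Ω → ℝ) (ψ : Vec p × ℝ)
    (DL DU : ℝ) : Prop where
  measurable_y : Measurable y
  measurable_x : Measurable x
  measurable_D : Measurable D
  bounded_x : ∃ 𝒳 : Set (Vec p), Bornology.IsBounded 𝒳 ∧ ∀ᵐ ω ∂P, x ω ∈ 𝒳
  DL_pos : 0 < DL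
  D_mem : ∀ᵐ ω ∂P, D ω ∈ Set.Icc DL DU
  law : HasCondDistrib y (fun ω => (x ω, D ω)) (marginalKernel ψ) P

lemma CorrectlySpecified.marginalModel [IsFiniteMeasure P] {θ y : ℕ → Ω → ℝ}
    {x : ℕ → Ω → Vec p} {D : ℕ → Ω → ℝ} {ψ : Vec p × ℝ} {DL DU : ℝ}
    (h : CorrectlySpecified P θ y x D ψ) (hs : SamplingCondition P y x D DL DU)
    (hx : CovariateCondition P x) (i : ℕ) : MarginalModel P (y i) (x i) (D i) ψ DL DU where
  measurable_y := hs.measurable_y i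
  measurable_x := hs.measurable_x i
  measurable_D := hs.measurable_D i
  bounded_x := hx.bounded.imp fun _ h𝒳 => ⟨h𝒳.1, h𝒳.2 i⟩
  DL_pos := hs.DL_pos
  D_mem := hs.D_mem i
  law := h.hasCondDistrib (hs.measurable_y i) (hs.measurable_x i) (hs.measurable_D i)

namespace MarginalModel

variable {y : Ω → ℝ} {x : Ω → Vec p} {D : Ω → ℝ} {ψ : Vec p × ℝ} {DL DU : ℝ}

lemma exists_isCompact (h : MarginalModel P y x D ψ DL DU) :
    ∃ C : Set (Vec p × ℝ), IsCompact C ∧ ∀ᵐ ω ∂P, (x ω, D ω) ∈ C := by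
  obtain ⟨𝒳, h𝒳, hx𝒳⟩ := h.bounded_x
  refine ⟨closure 𝒳 ×ˢ Set.Icc DL DU, h𝒳.isCompact_closure.prod isCompact_Icc, ?_⟩
  filter_upwards [hx𝒳, h.D_mem] with ω hxω hDω using ⟨subset_closure hxω, hDω⟩

lemma integrable_continuous_comp [IsFiniteMeasure P] (h : MarginalModel P y x D ψ DL DU)
    {f : Vec p × ℝ → ℝ} (hf : Continuous f) : Integrable (fun ω => f (x ω, D ω)) P := by
  obtain ⟨C, hC, hmem⟩ := h.exists_isCompact
  obtain ⟨B, hB⟩ := hC.exists_bound_of_continuousOn hf.continuousOn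
  exact Integrable.mono' (integrable_const B)
    (hf.measurable.comp (h.measurable_x.prodMk h.measurable_D)).aestronglyMeasurable
    (hmem.mono fun ω hω => hB _ hω)

lemma integrable_sq_observation [IsFiniteMeasure P] (h : MarginalModel P y x D ψ DL DU) :
    Integrable (fun ω => y ω ^ 2) P :=
  integrable_sq_of_hasCondDistrib_gaussianKernel h.law
    (h.integrable_continuous_comp (f := fun s => linPred s.1 ψ.1 ^ 2) (by fun_prop))
    (h.integrable_continuous_comp (f := fun s => ((ψ.2.toNNReal + s.2.toNNReal : ℝ≥0) : ℝ))
      (by fun_prop))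

lemma ae_marginalKernel_eq (h : MarginalModel P y x D ψ DL DU) (hψ : 0 < ψ.2) :
    ∀ᵐ ω ∂P, marginalKernel ψ (x ω, D ω)
      = gaussianReal (linPred (x ω) ψ.1) (ψ.2 + D ω).toNNReal := by
  filter_upwards [h.D_mem] with ω hω
  rw [Real.toNNReal_add hψ.le (h.DL_pos.le.trans hω.1)]
  rfl

lemma eq_of_ae_linPred_eq [IsFiniteMeasure P] (h : MarginalModel P y x D ψ DL DU)
    (hpos : (Matrix.of fun j k : Fin p => ∫ ω, x ω j * x ω k ∂P).PosDef) {β β' : Vec p}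
    (hβ : ∀ᵐ ω ∂P, linPred (x ω) β = linPred (x ω) β') : β = β' := by
  have hint (j k : Fin p) : Integrable (fun ω => x ω j * x ω k) P :=
    h.integrable_continuous_comp (f := fun s => s.1 j * s.1 k) (by fun_prop)
  have hzero : (fun j => β j - β' j) = 0 := by
    refine eq_zero_of_ae_dotProduct_eq_zero (X := fun ω j => x ω j) hint hpos ?_
    filter_upwards [hβ] with ω hω
    simpa only [dotProduct, linPred, mul_sub, Finset.sum_sub_distrib] using sub_eq_zero.2 hω
  ext j
  exact sub_eq_zero.1 (congrFun hzero j)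

end MarginalModel

end MarginalModel

section ClosedForms

/-- The normal log-likelihood of the observation `y`. -/
noncomputable def logLik (μ v y : ℝ) : ℝ :=
  -(1 / 2) * Real.log (2 * Real.pi * v) - (y - μ) ^ 2 / (2 * v)

/-- The observation-free factor of the `γ`-likelihood, where `κ` is the constant of proportionality
between its normaliser and the closed-form one. -/
noncomputable def weight (κ γ v : ℝ) : ℝ := κ * (2 * Real.pi * v) ^ (-γ / (2 * (1 + γ)))

/-- The closed form of the `γ`-likelihood for `γ > 0`. -/
noncomputable def powLik (κ γ μ v y : ℝ) : ℝ :=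
  weight κ γ v / γ * Real.exp (-γ * (y - μ) ^ 2 / (2 * v))

/-- The curvature of the `γ`-likelihood in the observation, for `γ > 0`. -/
noncomputable def powCurvature (κ γ μ v y : ℝ) : ℝ :=
  weight κ γ v * (γ * (y - μ) ^ 2 / v ^ 2 - 1 / v) * Real.exp (-γ * (y - μ) ^ 2 / (2 * v))

/-- A normaliser proportional to the closed form. The constant is at most that of
`integralNormaliser`, the larger of the two normalisations. -/
def IsScaledNormaliser (c : ℝ → ℝ → ℝ → ℝ) (γ : ℝ) : Prop :=
  ∃ κ ∈ Set.Ioc 0 ((1 + γ) ^ (γ / (2 * (1 + γ)))),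
    ∀ μ v, 0 < v → c γ μ v = κ * closedNormaliser γ μ v

variable {c : ℝ → ℝ → ℝ → ℝ} {κ γ μ v : ℝ}

lemma weight_pos (hκ : 0 < κ) (hv : 0 < v) : 0 < weight κ γ v := by
  unfold weight
  positivity

lemma log_weight (hκ : 0 < κ) (hv : 0 < v) :
    Real.log (weight κ γ v) = Real.log κ - γ / (2 * (1 + γ)) * Real.log (2 * Real.pi * v) := by
  rw [weight, Real.log_mul hκ.ne' (by positivity), Real.log_rpow (by positivity)]
  ring

lemma normalDensity_eq (hv : 0 < v) (y : ℝ) :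
    normalDensity μ v y
      = (2 * Real.pi * v) ^ (-(1 / 2) : ℝ) * Real.exp (-(y - μ) ^ 2 / (2 * v)) := by
  rw [normalDensity, gaussianPDFReal, Real.coe_toNNReal v hv.le, Real.rpow_neg (by positivity),
    Real.sqrt_eq_rpow]

lemma normalDensity_rpow (hv : 0 < v) (y a : ℝ) :
    normalDensity μ v y ^ a
      = (2 * Real.pi * v) ^ (-(1 / 2) * a) * Real.exp (-a * (y - μ) ^ 2 / (2 * v)) := by
  rw [normalDensity_eq hv, Real.mul_rpow (by positivity) (Real.exp_pos _).le,
    ← Real.rpow_mul (by positivity), ← Real.exp_mul]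
  congr 2
  ring

lemma integral_normalDensity_rpow {a : ℝ} (ha : 0 < a) (hv : 0 < v) :
    ∫ t, normalDensity μ v t ^ a = (2 * Real.pi * v) ^ ((1 - a) / 2) * a ^ (-(1 / 2) : ℝ) := by
  have hexp (t : ℝ) : -a * (t - μ) ^ 2 / (2 * v) = -(a / (2 * v)) * (t - μ) ^ 2 := by ring
  have hvar : Real.pi / (a / (2 * v)) = 2 * Real.pi * v * a⁻¹ := by field_simp
  simp_rw [normalDensity_rpow hv, hexp]
  rw [integral_const_mul,
    integral_sub_right_eq_self (fun t => Real.exp (-(a / (2 * v)) * t ^ 2)) μ,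
    integral_gaussian, hvar, Real.sqrt_eq_rpow,
    Real.mul_rpow (by positivity : 0 ≤ 2 * Real.pi * v) (by positivity : 0 ≤ a⁻¹),
    ← mul_assoc, ← Real.rpow_add (by positivity), Real.inv_rpow ha.le, Real.rpow_neg ha.le]
  congr 2
  ring

lemma integralNormaliser_eq (hγ : -1 < γ) (hv : 0 < v) :
    integralNormaliser γ μ v = (1 + γ) ^ (γ / (2 * (1 + γ))) * closedNormaliser γ μ v := by
  have hγ' : 0 < 1 + γ := by linarith
  rw [integralNormaliser, integral_normalDensity_rpow hγ' hv, closedNormaliser,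
    Real.mul_rpow (by positivity) (by positivity), ← Real.rpow_mul (by positivity),
    ← Real.rpow_mul (by positivity), mul_comm]
  congr 2 <;> field_simp
  ring

lemma isScaledNormaliser_integralNormaliser (hγ : -1 < γ) :
    IsScaledNormaliser integralNormaliser γ :=
  ⟨_, ⟨Real.rpow_pos_of_pos (by linarith) _, le_rfl⟩, fun _ _ => integralNormaliser_eq hγ⟩

lemma isScaledNormaliser_closedNormaliser (hγ : 0 ≤ γ) : IsScaledNormaliser closedNormaliser γ :=
  ⟨1, ⟨one_pos, Real.one_le_rpow (by linarith) (by positivity)⟩, fun _ _ _ => (one_mul _).symm⟩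

lemma gammaLik_zero (c : ℝ → ℝ → ℝ → ℝ) (hv : 0 < v) : gammaLik c 0 μ v = logLik μ v := by
  ext y
  rw [gammaLik, if_pos rfl, normalDensity_eq hv, Real.log_mul (by positivity) (Real.exp_pos _).ne',
    Real.log_rpow (by positivity), Real.log_exp, logLik]
  ring

lemma gammaLik_eq_powLik (hγ : 0 < γ) (hv : 0 < v) (hc : c γ μ v = κ * closedNormaliser γ μ v) :
    gammaLik c γ μ v = powLik κ γ μ v := by
  have hpow : (2 * Real.pi * v) ^ (-γ / (2 * (1 + γ)))
      = (2 * Real.pi * v) ^ (-(1 / 2) * γ) * (2 * Real.pi * v) ^ (γ ^ 2 / (2 * (1 + γ))) := by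
    rw [← Real.rpow_add (by positivity)]
    congr 1
    field_simp
    ring
  ext y
  rw [gammaLik, if_neg hγ.ne', normalDensity_rpow hv, hc, closedNormaliser, powLik, weight, hpow]
  ring

lemma hasDerivAt_logLik (hv : v ≠ 0) (y : ℝ) :
    HasDerivAt (logLik μ v) (-(y - μ) / v) y := by
  refine (((((hasDerivAt_id y).sub_const μ).pow 2).div_const (2 * v)).const_sub
    (-(1 / 2) * Real.log (2 * Real.pi * v))).congr_deriv ?_
  simp only [id]
  field_simp
  ring

lemma deriv_logLik (hv : v ≠ 0) : deriv (logLik μ v) = fun y => -(y - μ) / v :=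
  funext fun y => (hasDerivAt_logLik hv y).deriv

lemma iteratedDeriv_two_logLik (hv : v ≠ 0) : iteratedDeriv 2 (logLik μ v) = fun _ => -1 / v := by
  rw [iteratedDeriv_succ, iteratedDeriv_one, deriv_logLik hv]
  ext y
  exact ((((hasDerivAt_id y).sub_const μ).neg).div_const v).deriv

lemma hasDerivAt_exp_neg_sq (γ μ : ℝ) (hv : v ≠ 0) (y : ℝ) :
    HasDerivAt (fun y => Real.exp (-γ * (y - μ) ^ 2 / (2 * v)))
      (Real.exp (-γ * (y - μ) ^ 2 / (2 * v)) * (-γ * (y - μ) / v)) y := by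
  refine (((((hasDerivAt_id y).sub_const μ).pow 2).const_mul (-γ)).div_const
    (2 * v)).exp.congr_deriv ?_
  congr 1
  simp
  field_simp

lemma iteratedDeriv_two_powLik (hγ : γ ≠ 0) (hv : v ≠ 0) :
    iteratedDeriv 2 (powLik κ γ μ v) = powCurvature κ γ μ v := by
  have hderiv : deriv (powLik κ γ μ v) = fun y => weight κ γ v / γ *
      (Real.exp (-γ * (y - μ) ^ 2 / (2 * v)) * (-γ * (y - μ) / v)) :=
    funext fun y => ((hasDerivAt_exp_neg_sq γ μ hv y).const_mul _).deriv
  rw [iteratedDeriv_succ, iteratedDeriv_one, hderiv]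
  ext y
  refine (((hasDerivAt_exp_neg_sq γ μ hv y).mul
    ((((hasDerivAt_id y).sub_const μ).const_mul (-γ)).div_const v)).const_mul
      (weight κ γ v / γ)).deriv.trans ?_
  simp only [id, powCurvature]
  field_simp
  ring

lemma robustMean_zero {p : ℕ} (c : ℝ → ℝ → ℝ → ℝ) {ψ : Vec p × ℝ} {D : ℝ} (hv : 0 < ψ.2 + D)
    (y : ℝ) (x : Vec p) : robustMean c 0 ψ y x D = bayesMean ψ y x D := by
  rw [robustMean, gammaLik_zero c hv, deriv_logLik hv.ne', bayesMean]
  ring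

lemma robustVar_zero {p : ℕ} (c : ℝ → ℝ → ℝ → ℝ) {ψ : Vec p × ℝ} {D : ℝ} (hv : 0 < ψ.2 + D)
    (y : ℝ) (x : Vec p) : robustVar c 0 ψ y x D = bayesVar ψ.2 D := by
  rw [robustVar, gammaLik_zero c hv, iteratedDeriv_two_logLik hv.ne', bayesVar]
  field_simp
  ring

lemma robustVar_eq {p : ℕ} {ψ : Vec p × ℝ} {D : ℝ} (hγ : 0 < γ) (hv : 0 < ψ.2 + D) {x : Vec p}
    (hc : c γ (linPred x ψ.1) (ψ.2 + D) = κ * closedNormaliser γ (linPred x ψ.1) (ψ.2 + D))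
    (y : ℝ) :
    robustVar c γ ψ y x D = D + D ^ 2 * powCurvature κ γ (linPred x ψ.1) (ψ.2 + D) y := by
  rw [robustVar, gammaLik_eq_powLik hγ hv hc, iteratedDeriv_two_powLik hγ.ne' hv.ne']

end ClosedForms

section Propriety

variable {κ γ μ v m s : ℝ}

lemma gaussianPDFReal_mul_exp (hγ : 0 ≤ γ) (hs : 0 < s) (hv : 0 < v) (t : ℝ) :
    gaussianPDFReal m s.toNNReal t * Real.exp (-γ * (t - μ) ^ 2 / (2 * v))
      = √(v / (v + γ * s)) * Real.exp (-γ * (m - μ) ^ 2 / (2 * (v + γ * s)))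
        * gaussianPDFReal ((v * m + γ * s * μ) / (v + γ * s)) (s * v / (v + γ * s)).toNNReal t := by
  have : 0 < v + γ * s := by positivity
  have hs' : 0 < s * v / (v + γ * s) := by positivity
  have hscale : (√(2 * Real.pi * s))⁻¹
      = √(v / (v + γ * s)) * (√(2 * Real.pi * (s * v / (v + γ * s))))⁻¹ := by
    have hmul : 2 * Real.pi * (s * v / (v + γ * s)) = v / (v + γ * s) * (2 * Real.pi * s) := by
      ring
    have hne : √(v / (v + γ * s)) ≠ 0 := by positivity
    rw [hmul, Real.sqrt_mul (by positivity : 0 ≤ v / (v + γ * s)), mul_inv,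
      mul_inv_cancel_left₀ hne]
  have hsquare : -(t - m) ^ 2 / (2 * s) + -γ * (t - μ) ^ 2 / (2 * v)
      = -γ * (m - μ) ^ 2 / (2 * (v + γ * s)) +
        -(t - (v * m + γ * s * μ) / (v + γ * s)) ^ 2 / (2 * (s * v / (v + γ * s))) := by
    field_simp
    ring
  rw [gaussianPDFReal, gaussianPDFReal, Real.coe_toNNReal _ hs.le, Real.coe_toNNReal _ hs'.le,
    hscale, mul_assoc, ← Real.exp_add, hsquare, Real.exp_add]
  ring

lemma integral_gaussianReal_exp_mul (hγ : 0 ≤ γ) (hs : 0 < s) (hv : 0 < v) (h : ℝ → ℝ) :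
    ∫ t, Real.exp (-γ * (t - μ) ^ 2 / (2 * v)) * h t ∂(gaussianReal m s.toNNReal)
      = √(v / (v + γ * s)) * Real.exp (-γ * (m - μ) ^ 2 / (2 * (v + γ * s))) *
        ∫ t, h t ∂(gaussianReal ((v * m + γ * s * μ) / (v + γ * s))
          (s * v / (v + γ * s)).toNNReal) := by
  have hs' : 0 < s * v / (v + γ * s) := by positivity
  rw [integral_gaussianReal_eq_integral_smul (Real.toNNReal_pos.2 hs).ne',
    integral_gaussianReal_eq_integral_smul (Real.toNNReal_pos.2 hs').ne', ← integral_const_mul]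
  refine integral_congr_ae (Eventually.of_forall fun t => ?_)
  simp only [smul_eq_mul]
  rw [← mul_assoc, gaussianPDFReal_mul_exp hγ hs hv, mul_assoc]

/-- A likelihood is strictly proper for the normal family if its expectation under `N(m, s)` is
uniquely maximised at the parameter `(m, s)`. -/
def StrictlyProper (L : ℝ → ℝ → ℝ → ℝ) : Prop :=
  ∀ μ v m s : ℝ, 0 < v → 0 < s → (μ, v) ≠ (m, s) →
    ∫ t, L μ v t ∂(gaussianReal m s.toNNReal) < ∫ t, L m s t ∂(gaussianReal m s.toNNReal)

lemma integral_logLik (hs : 0 ≤ s) :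
    ∫ t, logLik μ v t ∂(gaussianReal m s.toNNReal)
      = -(1 / 2) * Real.log (2 * Real.pi * v) - (s + (m - μ) ^ 2) / (2 * v) := by
  unfold logLik
  rw [integral_sub (integrable_const _) ((integrable_sub_sq_gaussianReal _ _ _).div_const _),
    integral_div, integral_sub_sq_gaussianReal, Real.coe_toNNReal _ hs, integral_const,
    probReal_univ, one_smul]

lemma strictlyProper_logLik : StrictlyProper logLik := by
  intro μ v m s hv hs hne
  have hrisk : (s + (m - μ) ^ 2) / (2 * v) = s / v / 2 + (m - μ) ^ 2 / (2 * v) := by field_simp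
  have hrisk_self : (s + (m - m) ^ 2) / (2 * s) = 1 / 2 := by
    field_simp
    ring
  rw [integral_logLik hs.le, integral_logLik hs.le, Real.log_mul (by positivity) hv.ne',
    Real.log_mul (by positivity) hs.ne', hrisk, hrisk_self]
  by_cases h : v = s
  · subst h
    have hm : m - μ ≠ 0 := fun h => hne (by rw [sub_eq_zero.1 h])
    have hbias : 0 < (m - μ) ^ 2 / (2 * v) := by positivity
    rw [div_self hv.ne']
    linarith
  · have hlog := Real.log_lt_sub_one_of_pos (div_pos hs hv) fun h' =>
      h ((div_eq_one_iff_eq hv.ne').1 h').symm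
    rw [Real.log_div hs.ne' hv.ne'] at hlog
    have hbias : 0 ≤ (m - μ) ^ 2 / (2 * v) := by positivity
    linarith

lemma integral_powLik (hγ : 0 ≤ γ) (hv : 0 < v) (hs : 0 < s) :
    ∫ t, powLik κ γ μ v t ∂(gaussianReal m s.toNNReal)
      = weight κ γ v * √(v / (v + γ * s)) / γ *
        Real.exp (-γ * (m - μ) ^ 2 / (2 * (v + γ * s))) := by
  have h := integral_gaussianReal_exp_mul (μ := μ) (m := m) hγ hs hv fun _ => 1
  simp only [mul_one, integral_const, smul_eq_mul, probReal_univ] at h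
  unfold powLik
  rw [integral_const_mul, h]
  ring

lemma add_mul_log_lt_log_add (hγ : 0 < γ) (hv : 0 < v) (hs : 0 < s) (hne : v ≠ s) :
    1 / (1 + γ) * Real.log v + γ / (1 + γ) * Real.log s
      < Real.log (v + γ * s) - Real.log (1 + γ) := by
  have hmean : 1 / (1 + γ) * v + γ / (1 + γ) * s = (v + γ * s) / (1 + γ) := by ring
  have hconcave := strictConcaveOn_log_Ioi.2 (Set.mem_Ioi.2 hv) (Set.mem_Ioi.2 hs) hne
    (by positivity : 0 < 1 / (1 + γ)) (by positivity : 0 < γ / (1 + γ)) (by field_simp)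
  simpa only [smul_eq_mul, hmean, Real.log_div (by positivity : v + γ * s ≠ 0)
    (by positivity : 1 + γ ≠ 0)] using hconcave

lemma weight_mul_sqrt_lt (hκ : 0 < κ) (hγ : 0 < γ) (hv : 0 < v) (hs : 0 < s) (hne : v ≠ s) :
    weight κ γ v * √(v / (v + γ * s)) < weight κ γ s * √(s / (s + γ * s)) := by
  have hlog (u : ℝ) (hu : 0 < u) : Real.log (weight κ γ u * √(u / (u + γ * s)))
      = Real.log κ - γ / (2 * (1 + γ)) * (Real.log (2 * Real.pi) + Real.log u)
        + (Real.log u - Real.log (u + γ * s)) / 2 := by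
    rw [Real.log_mul (weight_pos hκ hu).ne' (by positivity), log_weight hκ hu,
      Real.log_mul (by positivity) hu.ne', Real.log_sqrt (by positivity),
      Real.log_div hu.ne' (by positivity)]
  have hself : Real.log (s + γ * s) = Real.log (1 + γ) + Real.log s := by
    rw [← Real.log_mul (by positivity) hs.ne']
    ring_nf
  have hhalf : γ / (2 * (1 + γ)) = γ / (1 + γ) / 2 := by field_simp
  have hcompl : 1 / (1 + γ) = 1 - γ / (1 + γ) := by
    field_simp
    ring
  have hmean := add_mul_log_lt_log_add hγ hv hs hne
  rw [hcompl] at hmean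
  have hwv := weight_pos (γ := γ) hκ hv
  have hws := weight_pos (γ := γ) hκ hs
  rw [← Real.log_lt_log_iff (by positivity) (by positivity), hlog v hv, hlog s hs, hself, hhalf]
  linarith

lemma strictlyProper_powLik (hκ : 0 < κ) (hγ : 0 < γ) : StrictlyProper (powLik κ γ) := by
  intro μ v m s hv hs hne
  have hw := weight_pos (γ := γ) hκ hv
  have hexp_self : Real.exp (-γ * (m - m) ^ 2 / (2 * (s + γ * s))) = 1 := by simp
  rw [integral_powLik hγ.le hv hs, integral_powLik hγ.le hs hs, hexp_self, mul_one]
  have hexponent : -γ * (m - μ) ^ 2 / (2 * (v + γ * s))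
      = -(γ * (m - μ) ^ 2 / (2 * (v + γ * s))) := by ring
  by_cases h : v = s
  · subst h
    have hm : m - μ ≠ 0 := fun h => hne (by rw [sub_eq_zero.1 h])
    refine mul_lt_of_lt_one_right (by positivity) (Real.exp_lt_one_iff.2 ?_)
    rw [hexponent]
    exact neg_neg_of_pos (by positivity)
  · refine (mul_le_of_le_one_right (by positivity) (Real.exp_le_one_iff.2 ?_)).trans_lt
      (div_lt_div_of_pos_right (weight_mul_sqrt_lt hκ hγ hv hs h) hγ)
    rw [hexponent]
    exact neg_nonpos.2 (by positivity)

lemma strictlyProper_congr {L L' : ℝ → ℝ → ℝ → ℝ} (h : ∀ μ v, 0 < v → L μ v = L' μ v)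
    (hL : StrictlyProper L') : StrictlyProper L := by
  intro μ v m s hv hs hne
  rw [h μ v hv, h m s hs]
  exact hL μ v m s hv hs hne

lemma strictlyProper_gammaLik {c : ℝ → ℝ → ℝ → ℝ} (hγ : 0 ≤ γ)
    (hc : 0 < γ → IsScaledNormaliser c γ) : StrictlyProper (gammaLik c γ) := by
  rcases hγ.eq_or_lt with rfl | hγ
  · exact strictlyProper_congr (fun _ _ => gammaLik_zero c) strictlyProper_logLik
  · obtain ⟨κ, hκ, hcκ⟩ := hc hγ
    exact strictlyProper_congr (fun μ v hv => gammaLik_eq_powLik hγ hv (hcκ μ v hv))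
      (strictlyProper_powLik hκ.1 hγ)

end Propriety

section Curvature

variable {κ γ μ v : ℝ}

lemma integral_powCurvature (hγ : 0 ≤ γ) (hv : 0 < v) :
    ∫ t, powCurvature κ γ μ v t ∂(gaussianReal μ v.toNNReal)
      = -(weight κ γ v / ((1 + γ) * √(1 + γ))) / v := by
  have hmean : (v * μ + γ * v * μ) / (v + γ * v) = μ := by field_simp
  have hvar : v * v / (v + γ * v) = v / (1 + γ) := by field_simp
  have hratio : v / (v + γ * v) = (1 + γ)⁻¹ := by field_simp
  have hfactor (t : ℝ) : powCurvature κ γ μ v t = weight κ γ v *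
      (Real.exp (-γ * (t - μ) ^ 2 / (2 * v)) * (γ * (t - μ) ^ 2 / v ^ 2 - 1 / v)) := by
    rw [powCurvature]
    ring
  simp_rw [hfactor]
  rw [integral_const_mul, integral_gaussianReal_exp_mul hγ hv hv, hmean, hvar, hratio,
    integral_sub (((integrable_sub_sq_gaussianReal _ _ _).const_mul _).div_const _)
      (integrable_const _), integral_div, integral_const_mul, integral_sub_sq_gaussianReal,
    Real.coe_toNNReal _ (by positivity), Real.sqrt_inv, sub_self, integral_const, probReal_univ,
    one_smul]
  simp only [ne_eq, OfNat.ofNat_ne_zero, not_false_eq_true, zero_pow, mul_zero, zero_div,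
    Real.exp_zero, mul_one, add_zero]
  field_simp
  ring

lemma three_mul_le_mul_log_one_add (hγ : 0 ≤ γ) : 3 * γ ≤ (3 + 2 * γ) * Real.log (1 + γ) := by
  have hpade : 3 * γ / (3 + 2 * γ) ≤ 2 * γ / (γ + 2) := by
    rw [div_le_div_iff₀ (by positivity) (by positivity)]
    nlinarith [sq_nonneg γ]
  exact (div_le_iff₀' (by positivity)).1 (hpade.trans (Real.le_log_one_add_of_nonneg hγ))

lemma weight_lt (hγ : 0 < γ) (hκ : κ ∈ Set.Ioc 0 ((1 + γ) ^ (γ / (2 * (1 + γ)))))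
    (hv : (2 * Real.pi)⁻¹ * Real.exp (-3) < v) : weight κ γ v < (1 + γ) * √(1 + γ) := by
  have hv0 : 0 < v := lt_trans (by positivity) hv
  have hlogv : -3 < Real.log (2 * Real.pi * v) := by
    rw [Real.lt_log_iff_exp_lt (by positivity)]
    exact (inv_mul_lt_iff₀ (by positivity)).1 hv
  have hlogκ : Real.log κ ≤ γ / (2 * (1 + γ)) * Real.log (1 + γ) := by
    rw [← Real.log_rpow (by positivity)]
    exact Real.log_le_log hκ.1 hκ.2
  rw [← Real.log_lt_log_iff (weight_pos hκ.1 hv0) (by positivity), log_weight hκ.1 hv0,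
    Real.log_mul (by positivity : 1 + γ ≠ 0) (by positivity), Real.log_sqrt (by positivity)]
  have hscaled := mul_lt_mul_of_pos_left hlogv (by positivity : 0 < γ / (2 * (1 + γ)))
  calc Real.log κ - γ / (2 * (1 + γ)) * Real.log (2 * Real.pi * v)
    _ < γ / (2 * (1 + γ)) * Real.log (1 + γ) - γ / (2 * (1 + γ)) * (-3) := by linarith
    _ = (γ * Real.log (1 + γ) + 3 * γ) / (2 * (1 + γ)) := by ring
    _ ≤ Real.log (1 + γ) + Real.log (1 + γ) / 2 := by
      rw [div_le_iff₀ (by positivity)]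
      linarith [three_mul_le_mul_log_one_add hγ.le]

lemma neg_one_div_lt_integral_powCurvature (hγ : 0 < γ)
    (hκ : κ ∈ Set.Ioc 0 ((1 + γ) ^ (γ / (2 * (1 + γ)))))
    (hv : (2 * Real.pi)⁻¹ * Real.exp (-3) < v) :
    -1 / v < ∫ t, powCurvature κ γ μ v t ∂(gaussianReal μ v.toNNReal) := by
  have hv0 : 0 < v := lt_trans (by positivity) hv
  rw [integral_powCurvature hγ.le hv0]
  refine div_lt_div_of_pos_right (neg_lt_neg ?_) hv0
  exact (div_lt_one (by positivity)).2 (weight_lt hγ hκ hv)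

lemma abs_powCurvature_le (hκ : 0 < κ) (hγ : 0 ≤ γ) (hv : 0 < v) (y : ℝ) :
    |powCurvature κ γ μ v y| ≤ weight κ γ v * (3 / v) := by
  have hw := weight_pos (γ := γ) hκ hv
  set u := γ * (y - μ) ^ 2 / (2 * v) with hu
  have hu0 : 0 ≤ u := by positivity
  have hexponent : -γ * (y - μ) ^ 2 / (2 * v) = -u := by
    rw [hu]
    ring
  have hfactor : γ * (y - μ) ^ 2 / v ^ 2 - 1 / v = (2 * u - 1) / v := by
    rw [hu]
    field_simp
  have hpos := Real.exp_pos (-u)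
  have hexp : Real.exp (-u) ≤ 1 := Real.exp_le_one_iff.2 (neg_nonpos.2 hu0)
  have hmul_exp : u * Real.exp (-u) ≤ 1 := by
    rw [Real.exp_neg, ← div_eq_mul_inv, div_le_one (Real.exp_pos _)]
    linarith [Real.add_one_le_exp u]
  rw [powCurvature, hexponent, hfactor, mul_assoc, abs_mul, abs_of_pos hw, div_mul_eq_mul_div,
    abs_div, abs_of_pos hv]
  refine mul_le_mul_of_nonneg_left (div_le_div_of_nonneg_right (abs_le.2 ⟨?_, ?_⟩) hv.le) hw.le
    <;> nlinarith

lemma integrable_powCurvature (hκ : 0 < κ) (hγ : 0 ≤ γ) (hv : 0 < v) (ν : Measure ℝ)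
    [IsFiniteMeasure ν] : Integrable (powCurvature κ γ μ v) ν := by
  refine Integrable.mono' (integrable_const _) (Continuous.aestronglyMeasurable ?_)
    (Eventually.of_forall fun t => abs_powCurvature_le hκ hγ hv t)
  unfold powCurvature
  fun_prop

lemma bayesVar_lt_integral_robustVar {p : ℕ} {c : ℝ → ℝ → ℝ → ℝ} (hγ : 0 < γ)
    (hc : IsScaledNormaliser c γ) {ψ : Vec p × ℝ} {D : ℝ} (hD : D ≠ 0)
    (hv : (2 * Real.pi)⁻¹ * Real.exp (-3) < ψ.2 + D) (x : Vec p) :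
    bayesVar ψ.2 D
      < ∫ t, robustVar c γ ψ t x D ∂(gaussianReal (linPred x ψ.1) (ψ.2 + D).toNNReal) := by
  have hv0 : 0 < ψ.2 + D := lt_trans (by positivity) hv
  obtain ⟨κ, hκ, hcκ⟩ := hc
  simp_rw [robustVar_eq hγ hv0 (hcκ _ _ hv0)]
  rw [integral_add (integrable_const _)
    ((integrable_powCurvature hκ.1 hγ.le hv0 _).const_mul _), integral_const_mul, integral_const,
    probReal_univ, one_smul]
  calc bayesVar ψ.2 D = D + D ^ 2 * (-1 / (ψ.2 + D)) := by
        rw [bayesVar]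
        field_simp
        ring
    _ < _ := by
      gcongr
      exact neg_one_div_lt_integral_powCurvature hγ hκ hv

end Curvature

section QuadraticGrowth

/-- A function of a parameter `q` and an observation `y` that is continuous and grows at most
quadratically in `y`, locally uniformly in `q`. A strong law for such functions, uniform in `q`,
needs only a second moment of the observation. -/
structure QuadraticGrowth {Q : Type*} [TopologicalSpace Q] (f : Q → ℝ → ℝ) : Prop where
  continuous : Continuous fun z : Q × ℝ => f z.1 z.2
  exists_bound : ∃ C : Q → ℝ, Continuous C ∧ ∀ q y, |f q y| ≤ C q * (1 + y ^ 2)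

section Likelihoods

variable {Q : Type*} [TopologicalSpace Q] {c : ℝ → ℝ → ℝ → ℝ} {κ γ : ℝ} {m v : Q → ℝ}

lemma QuadraticGrowth.of_abs_le {f : Q → ℝ → ℝ} {C : Q → ℝ}
    (hf : Continuous fun z : Q × ℝ => f z.1 z.2) (hC : Continuous C) (h : ∀ q y, |f q y| ≤ C q) :
    QuadraticGrowth f where
  continuous := hf
  exists_bound := ⟨C, hC, fun q y => (h q y).trans
    (le_mul_of_one_le_right ((abs_nonneg _).trans (h q y)) (by linarith [sq_nonneg y]))⟩

lemma continuous_weight (hv : Continuous v) (hv0 : ∀ q, 0 < v q) :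
    Continuous fun q => weight κ γ (v q) :=
  ((hv.const_mul (2 * Real.pi)).rpow_const fun q =>
    Or.inl (mul_pos (by positivity) (hv0 q)).ne').const_mul κ

lemma continuous_exp_neg_sq (hm : Continuous m) (hv : Continuous v) (hv0 : ∀ q, 0 < v q) :
    Continuous fun z : Q × ℝ => Real.exp (-γ * (z.2 - m z.1) ^ 2 / (2 * v z.1)) := by
  have hne (z : Q × ℝ) : 2 * v z.1 ≠ 0 := (mul_pos two_pos (hv0 z.1)).ne'
  fun_prop (disch := exact hne _)

lemma quadraticGrowth_logLik (hm : Continuous m) (hv : Continuous v) (hv0 : ∀ q, 0 < v q) :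
    QuadraticGrowth fun q => logLik (m q) (v q) where
  continuous := by
    have hlog (z : Q × ℝ) : 2 * Real.pi * v z.1 ≠ 0 := (mul_pos (by positivity) (hv0 z.1)).ne'
    have hne (z : Q × ℝ) : 2 * v z.1 ≠ 0 := (mul_pos two_pos (hv0 z.1)).ne'
    unfold logLik
    fun_prop (disch := first | exact hlog _ | exact hne _)
  exists_bound := by
    have hlog (q : Q) : 2 * Real.pi * v q ≠ 0 := (mul_pos (by positivity) (hv0 q)).ne'
    have hne (q : Q) : v q ≠ 0 := (hv0 q).ne'
    refine ⟨fun q => |-(1 / 2) * Real.log (2 * Real.pi * v q)| + (1 + m q ^ 2) / v q,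
      by fun_prop (disch := first | exact hlog _ | exact hne _), fun q y => ?_⟩
    have hv := hv0 q
    have hsq : (y - m q) ^ 2 ≤ 2 * ((1 + m q ^ 2) * (1 + y ^ 2)) := by
      nlinarith [sq_nonneg (y + m q), sq_nonneg (y * m q)]
    have hquad : |(y - m q) ^ 2 / (2 * v q)| ≤ (1 + m q ^ 2) / v q * (1 + y ^ 2) := by
      rw [abs_of_nonneg (by positivity), div_mul_eq_mul_div, div_le_div_iff₀ (by positivity) hv]
      linarith [mul_le_mul_of_nonneg_right hsq hv.le]
    rw [logLik, add_mul]
    refine (abs_sub _ _).trans (add_le_add (le_mul_of_one_le_right (abs_nonneg _) ?_) hquad)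
    linarith [sq_nonneg y]

lemma quadraticGrowth_powLik (hκ : 0 < κ) (hγ : 0 < γ) (hm : Continuous m) (hv : Continuous v)
    (hv0 : ∀ q, 0 < v q) : QuadraticGrowth fun q => powLik κ γ (m q) (v q) := by
  have hw := continuous_weight (κ := κ) (γ := γ) hv hv0
  have hexp := continuous_exp_neg_sq (γ := γ) hm hv hv0
  refine .of_abs_le (C := fun q => weight κ γ (v q) / γ) ?_ (by fun_prop) fun q y => ?_
  · exact ((hw.comp continuous_fst).div_const γ).mul hexp
  · have hwq := weight_pos (γ := γ) hκ (hv0 q)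
    have hv := hv0 q
    rw [powLik, abs_of_pos (by positivity)]
    refine mul_le_of_le_one_right (by positivity) (Real.exp_le_one_iff.2 ?_)
    rw [neg_mul, neg_div]
    exact neg_nonpos.2 (by positivity)

lemma quadraticGrowth_gammaLik (hγ : 0 ≤ γ) (hc : 0 < γ → IsScaledNormaliser c γ)
    (hm : Continuous m) (hv : Continuous v) (hv0 : ∀ q, 0 < v q) :
    QuadraticGrowth fun q => gammaLik c γ (m q) (v q) := by
  rcases hγ.eq_or_lt with rfl | hγ
  · simp_rw [gammaLik_zero c (hv0 _)]
    exact quadraticGrowth_logLik hm hv hv0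
  · obtain ⟨κ, hκ, hcκ⟩ := hc hγ
    simp_rw [gammaLik_eq_powLik hγ (hv0 _) (hcκ _ _ (hv0 _))]
    exact quadraticGrowth_powLik hκ.1 hγ hm hv hv0

lemma continuous_powCurvature (hm : Continuous m) (hv : Continuous v) (hv0 : ∀ q, 0 < v q) :
    Continuous fun z : Q × ℝ => powCurvature κ γ (m z.1) (v z.1) z.2 := by
  have hne (z : Q × ℝ) : v z.1 ≠ 0 := (hv0 z.1).ne'
  have hsq (z : Q × ℝ) : v z.1 ^ 2 ≠ 0 := pow_ne_zero 2 (hne z)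
  have hquad : Continuous fun z : Q × ℝ => γ * (z.2 - m z.1) ^ 2 / v z.1 ^ 2 - 1 / v z.1 := by
    fun_prop (disch := first | exact hsq _ | exact hne _)
  exact (((continuous_weight hv hv0).comp continuous_fst).mul hquad).mul
    (continuous_exp_neg_sq hm hv hv0)

lemma quadraticGrowth_robustVar {p : ℕ} {ψ : Q → Vec p × ℝ} {x : Q → Vec p} {D : Q → ℝ}
    (hγ : 0 ≤ γ) (hc : 0 < γ → IsScaledNormaliser c γ) (hψ : Continuous ψ) (hx : Continuous x)
    (hD : Continuous D) (hv : ∀ q, 0 < (ψ q).2 + D q) :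
    QuadraticGrowth fun q y => robustVar c γ (ψ q) y (x q) (D q) := by
  have hm : Continuous fun q => linPred (x q) (ψ q).1 := by fun_prop
  have hvc : Continuous fun q => (ψ q).2 + D q := by fun_prop
  have hne (q : Q) : (ψ q).2 + D q ≠ 0 := (hv q).ne'
  rcases hγ.eq_or_lt with rfl | hγ
  · have hcont : Continuous fun q => bayesVar (ψ q).2 (D q) := by
      unfold bayesVar
      fun_prop (disch := exact hne _)
    simp_rw [robustVar_zero c (hv _)]
    exact .of_abs_le (hcont.comp continuous_fst) hcont.abs fun _ _ => le_rfl
  · obtain ⟨κ, hκ, hcκ⟩ := hc hγ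
    have hw := continuous_weight (κ := κ) (γ := γ) hvc hv
    have hcurv := continuous_powCurvature (κ := κ) (γ := γ) hm hvc hv
    simp_rw [robustVar_eq hγ (hv _) (hcκ _ _ (hv _))]
    refine .of_abs_le
      (C := fun q => |D q| + D q ^ 2 * (weight κ γ ((ψ q).2 + D q) * (3 / ((ψ q).2 + D q))))
      (by fun_prop) (by fun_prop (disch := exact hne _)) fun q y => (abs_add_le _ _).trans ?_
    rw [abs_mul, abs_sq]
    gcongr
    exact abs_powCurvature_le hκ.1 hγ.le (hv q) y

end Likelihoods

lemma QuadraticGrowth.exists_integrable_continuousMap {Ω 𝒵 K : Type*} [MeasurableSpace Ω]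
    {P : Measure Ω} [TopologicalSpace 𝒵] [SecondCountableTopology 𝒵] [MeasurableSpace 𝒵]
    [OpensMeasurableSpace 𝒵] [TopologicalSpace K] [CompactSpace K] [IsFiniteMeasure P]
    {f : 𝒵 × K → ℝ → ℝ} (hf : QuadraticGrowth f) {Y : Ω → ℝ} {Z : Ω → 𝒵} (hY : Measurable Y)
    (hZ : Measurable Z) (hsq : Integrable (fun ω => Y ω ^ 2) P) {C : Set 𝒵} (hC : IsCompact C)
    (hZC : ∀ᵐ ω ∂P, Z ω ∈ C) :
    ∃ F : C(ℝ × 𝒵, C(K, ℝ)),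
      (∀ t z k, F (t, z) k = f (z, k) t) ∧ Integrable (fun ω => F (Y ω, Z ω)) P := by
  obtain ⟨b, hb, hfb⟩ := hf.exists_bound
  obtain ⟨B, hB⟩ := (hC.prod isCompact_univ).exists_bound_of_continuousOn hb.continuousOn
  let F : C(ℝ × 𝒵, C(K, ℝ)) := ContinuousMap.curry
    ⟨fun w => f (w.1.2, w.2) w.1.1, hf.continuous.comp
      (by fun_prop : Continuous fun w : (ℝ × 𝒵) × K => ((w.1.2, w.2), w.1.1))⟩
  have hmeas : AEStronglyMeasurable (fun ω => F (Y ω, Z ω)) P :=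
    (F.continuous.stronglyMeasurable.comp_measurable (hY.prodMk hZ)).aestronglyMeasurable
  have hdom : Integrable (fun ω => |B| * (1 + Y ω ^ 2)) P :=
    ((integrable_const 1).add hsq).const_mul |B|
  refine ⟨F, fun _ _ _ => rfl, hdom.mono' hmeas
    (hZC.mono fun ω hω => (ContinuousMap.norm_le _ (by positivity)).2 fun k => ?_)⟩
  have hbound : b (Z ω, k) ≤ |B| :=
    ((le_abs_self _).trans (hB (Z ω, k) ⟨hω, Set.mem_univ k⟩)).trans (le_abs_self B)
  exact (hfb (Z ω, k) (Y ω)).trans (mul_le_mul_of_nonneg_right hbound (by positivity))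

end QuadraticGrowth

namespace MarginalModel

variable {Ω : Type*} [MeasurableSpace Ω] {P : Measure Ω} {p : ℕ} {y : Ω → ℝ} {x : Ω → Vec p}
  {D : Ω → ℝ} {ψ ψstar : Vec p × ℝ} {DL DU γ : ℝ} {c : ℝ → ℝ → ℝ → ℝ}

section ContinuousMap

variable [IsFiniteMeasure P] {K : Type*} [TopologicalSpace K] [CompactSpace K]
  {φ : K → Vec p × ℝ}

-- Truncating the sampling variance at `DL` keeps the variance positive off the support of `D`.
lemma exists_continuousMap_gammaLik (h : MarginalModel P y x D ψstar DL DU) (hγ : 0 ≤ γ)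
    (hc : 0 < γ → IsScaledNormaliser c γ) (hφ : Continuous φ) (hφ0 : ∀ k, 0 < (φ k).2) :
    ∃ F : C(ℝ × Vec p × ℝ, C(K, ℝ)),
      (∀ t s k, DL ≤ s.2 → F (t, s) k = gammaLik c γ (linPred s.1 (φ k).1) ((φ k).2 + s.2) t) ∧
      Integrable (fun ω => F (y ω, x ω, D ω)) P := by
  obtain ⟨C, hC, hmem⟩ := h.exists_isCompact
  have hgrowth : QuadraticGrowth fun q : (Vec p × ℝ) × K =>
      gammaLik c γ (linPred q.1.1 (φ q.2).1) ((φ q.2).2 + max q.1.2 DL) :=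
    quadraticGrowth_gammaLik hγ hc (by fun_prop) (by fun_prop) fun q =>
      add_pos (hφ0 q.2) (lt_max_of_lt_right h.DL_pos)
  obtain ⟨F, hF, hint⟩ := hgrowth.exists_integrable_continuousMap h.measurable_y
    (h.measurable_x.prodMk h.measurable_D) h.integrable_sq_observation hC hmem
  exact ⟨F, fun t s k hs => by rw [hF, max_eq_left hs], hint⟩

lemma exists_continuousMap_robustVar (h : MarginalModel P y x D ψstar DL DU) (hγ : 0 ≤ γ)
    (hc : 0 < γ → IsScaledNormaliser c γ) (hφ : Continuous φ) (hφ0 : ∀ k, 0 < (φ k).2) :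
    ∃ F : C(ℝ × Vec p × ℝ, C(K, ℝ)),
      (∀ t s k, DL ≤ s.2 → F (t, s) k = robustVar c γ (φ k) t s.1 s.2) ∧
      Integrable (fun ω => F (y ω, x ω, D ω)) P := by
  obtain ⟨C, hC, hmem⟩ := h.exists_isCompact
  have hgrowth : QuadraticGrowth fun (q : (Vec p × ℝ) × K) t =>
      robustVar c γ (φ q.2) t q.1.1 (max q.1.2 DL) :=
    quadraticGrowth_robustVar hγ hc (by fun_prop) (by fun_prop) (by fun_prop) fun q =>
      add_pos (hφ0 q.2) (lt_max_of_lt_right h.DL_pos)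
  obtain ⟨F, hF, hint⟩ := hgrowth.exists_integrable_continuousMap h.measurable_y
    (h.measurable_x.prodMk h.measurable_D) h.integrable_sq_observation hC hmem
  exact ⟨F, fun t s k hs => by rw [hF, max_eq_left hs], hint⟩

lemma integral_lt_integral (h : MarginalModel P y x D ψstar DL DU) (hψstar : 0 < ψstar.2) (k : K)
    {F G : C(ℝ × Vec p × ℝ, C(K, ℝ))} {f g : Vec p × ℝ → ℝ → ℝ}
    (hF : ∀ t s, DL ≤ s.2 → F (t, s) k = f s t) (hG : ∀ t s, DL ≤ s.2 → G (t, s) k = g s t)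
    (hFint : Integrable (fun ω => F (y ω, x ω, D ω)) P)
    (hGint : Integrable (fun ω => G (y ω, x ω, D ω)) P)
    (hle : ∀ᵐ ω ∂P,
      ∫ t, f (x ω, D ω) t ∂(gaussianReal (linPred (x ω) ψstar.1) (ψstar.2 + D ω).toNNReal)
        ≤ ∫ t, g (x ω, D ω) t ∂(gaussianReal (linPred (x ω) ψstar.1) (ψstar.2 + D ω).toNNReal))
    (hlt : ∃ᵐ ω ∂P,
      ∫ t, f (x ω, D ω) t ∂(gaussianReal (linPred (x ω) ψstar.1) (ψstar.2 + D ω).toNNReal)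
        < ∫ t, g (x ω, D ω) t ∂(gaussianReal (linPred (x ω) ψstar.1) (ψstar.2 + D ω).toNNReal)) :
    ∫ ω, f (x ω, D ω) (y ω) ∂P < ∫ ω, g (x ω, D ω) (y ω) ∂P := by
  have hmeas (H : C(ℝ × Vec p × ℝ, C(K, ℝ))) :
      StronglyMeasurable fun z : (Vec p × ℝ) × ℝ => H (z.2, z.1) k :=
    Continuous.stronglyMeasurable (by fun_prop)
  have hint {H : C(ℝ × Vec p × ℝ, C(K, ℝ))} (hH : Integrable (fun ω => H (y ω, x ω, D ω)) P) :
      Integrable (fun ω => H (y ω, x ω, D ω) k) P :=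
    (ContinuousMap.evalCLM ℝ k).integrable_comp hH
  have hsection : ∀ᵐ ω ∂P, ∀ t,
      f (x ω, D ω) t = F (t, x ω, D ω) k ∧ g (x ω, D ω) t = G (t, x ω, D ω) k :=
    h.D_mem.mono fun ω hω t => ⟨(hF t _ hω.1).symm, (hG t _ hω.1).symm⟩
  have hkernel := h.ae_marginalKernel_eq hψstar
  rw [integral_congr_ae (hsection.mono fun ω hω => (hω (y ω)).1),
    integral_congr_ae (hsection.mono fun ω hω => (hω (y ω)).2)]
  refine integral_lt_integral_of_hasCondDistrib h.law (hmeas F) (hmeas G) (hint hFint)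
    (hint hGint) ?_ ?_
  · filter_upwards [hle, hsection, hkernel] with ω hω hs hκ
    simpa only [hκ, fun t => (hs t).1, fun t => (hs t).2] using hω
  · refine (hlt.and_eventually (hsection.and hkernel)).mono fun ω ⟨hω, hs, hκ⟩ => ?_
    simpa only [hκ, fun t => (hs t).1, fun t => (hs t).2] using hω

end ContinuousMap

variable [IsFiniteMeasure P] [NeZero P]

lemma frequently_ne_of_ne (h : MarginalModel P y x D ψstar DL DU)
    (hpos : (Matrix.of fun j k : Fin p => ∫ ω, x ω j * x ω k ∂P).PosDef) (hne : ψ ≠ ψstar) :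
    ∃ᵐ ω ∂P, (linPred (x ω) ψ.1, ψ.2 + D ω) ≠ (linPred (x ω) ψstar.1, ψstar.2 + D ω) := by
  refine fun hcontra => hne ?_
  simp only [not_not, Prod.mk.injEq] at hcontra
  obtain ⟨ω, hω⟩ := hcontra.exists
  exact Prod.ext (h.eq_of_ae_linPred_eq hpos (hcontra.mono fun ω hω => hω.1))
    (add_right_cancel hω.2)

lemma integral_gammaLik_lt (h : MarginalModel P y x D ψstar DL DU)
    (hpos : (Matrix.of fun j k : Fin p => ∫ ω, x ω j * x ω k ∂P).PosDef) (hγ : 0 ≤ γ)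
    (hc : 0 < γ → IsScaledNormaliser c γ) (hψ : 0 < ψ.2) (hψstar : 0 < ψstar.2)
    (hne : ψ ≠ ψstar) :
    ∫ ω, gammaLik c γ (linPred (x ω) ψ.1) (ψ.2 + D ω) (y ω) ∂P
      < ∫ ω, gammaLik c γ (linPred (x ω) ψstar.1) (ψstar.2 + D ω) (y ω) ∂P := by
  have hproper := strictlyProper_gammaLik hγ hc
  have hvar : ∀ᵐ ω ∂P, 0 < ψ.2 + D ω ∧ 0 < ψstar.2 + D ω := h.D_mem.mono fun ω hω =>
    have hD := h.DL_pos.trans_le hω.1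
    ⟨add_pos hψ hD, add_pos hψstar hD⟩
  obtain ⟨F, hF, hFint⟩ := h.exists_continuousMap_gammaLik hγ hc
    (continuous_const (X := Unit) (y := ψ)) fun _ => hψ
  obtain ⟨G, hG, hGint⟩ := h.exists_continuousMap_gammaLik hγ hc
    (continuous_const (X := Unit) (y := ψstar)) fun _ => hψstar
  refine h.integral_lt_integral hψstar ()
    (f := fun s => gammaLik c γ (linPred s.1 ψ.1) (ψ.2 + s.2))
    (g := fun s => gammaLik c γ (linPred s.1 ψstar.1) (ψstar.2 + s.2))
    (fun t s => hF t s ()) (fun t s => hG t s ()) hFint hGint ?_ ?_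
  · filter_upwards [hvar] with ω hω
    by_cases heq : (linPred (x ω) ψ.1, ψ.2 + D ω) = (linPred (x ω) ψstar.1, ψstar.2 + D ω)
    · rw [(Prod.mk.inj heq).1, (Prod.mk.inj heq).2]
    · exact (hproper _ _ _ _ hω.1 hω.2 heq).le
  · exact ((h.frequently_ne_of_ne hpos hne).and_eventually hvar).mono
      fun ω hω => hproper _ _ _ _ hω.2.1 hω.2.2 hω.1

lemma integral_robustVar_zero_lt (h : MarginalModel P y x D ψstar DL DU) (hγ : 0 < γ)
    (hc : IsScaledNormaliser c γ) (hψstar : 0 < ψstar.2)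
    (hlower : (2 * Real.pi)⁻¹ * Real.exp (-3) < ψstar.2 + DL) :
    ∫ ω, robustVar c 0 ψstar (y ω) (x ω) (D ω) ∂P
      < ∫ ω, robustVar c γ ψstar (y ω) (x ω) (D ω) ∂P := by
  obtain ⟨F, hF, hFint⟩ := h.exists_continuousMap_robustVar le_rfl
    (fun h => absurd h (lt_irrefl 0)) (continuous_const (X := Unit) (y := ψstar)) fun _ => hψstar
  obtain ⟨G, hG, hGint⟩ := h.exists_continuousMap_robustVar hγ.le (fun _ => hc)
    (continuous_const (X := Unit) (y := ψstar)) fun _ => hψstar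
  have hlt : ∀ᵐ ω ∂P, ∫ t, robustVar c 0 ψstar t (x ω) (D ω)
        ∂(gaussianReal (linPred (x ω) ψstar.1) (ψstar.2 + D ω).toNNReal)
      < ∫ t, robustVar c γ ψstar t (x ω) (D ω)
        ∂(gaussianReal (linPred (x ω) ψstar.1) (ψstar.2 + D ω).toNNReal) := by
    filter_upwards [h.D_mem] with ω hω
    have hD := h.DL_pos.trans_le hω.1
    simp_rw [robustVar_zero c (add_pos hψstar hD)]
    rw [integral_const, probReal_univ, one_smul]
    exact bayesVar_lt_integral_robustVar hγ hc hD.ne' (by linarith [hω.1]) (x ω)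
  exact h.integral_lt_integral hψstar () (f := fun s t => robustVar c 0 ψstar t s.1 s.2)
    (g := fun s t => robustVar c γ ψstar t s.1 s.2) (fun t s => hF t s ()) (fun t s => hG t s ())
    hFint hGint (hlt.mono fun ω hω => hω.le) hlt.frequently

end MarginalModel

section Sample

variable {Ω : Type*} [MeasurableSpace Ω] {P : Measure Ω} {p : ℕ} {y : ℕ → Ω → ℝ}
  {x : ℕ → Ω → Vec p} {D : ℕ → Ω → ℝ} {ψstar : Vec p × ℝ} {DL DU : ℝ}

lemma MarginalModel.ae_forall_mem_Icc (h : MarginalModel P (y 0) (x 0) (D 0) ψstar DL DU)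
    (hident : ∀ i, IdentDistrib (fun ω => (y i ω, x i ω, D i ω))
      (fun ω => (y 0 ω, x 0 ω, D 0 ω)) P P) : ∀ᵐ ω ∂P, ∀ i, D i ω ∈ Set.Icc DL DU :=
  ae_all_iff.2 fun i => (hident i).symm.ae_snd (p := fun z => z.2.2 ∈ Set.Icc DL DU)
    (measurableSet_Icc.preimage (by fun_prop)) h.D_mem

lemma ae_tendsto_average_totalVar [IsProbabilityMeasure P] {Ψ : Set (Vec p × ℝ)} {γ : ℝ}
    {c : ℝ → ℝ → ℝ → ℝ} (h : MarginalModel P (y 0) (x 0) (D 0) ψstar DL DU)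
    (hindep : Pairwise fun i j => IndepFun (fun ω => (y i ω, x i ω, D i ω))
      (fun ω => (y j ω, x j ω, D j ω)) P)
    (hident : ∀ i, IdentDistrib (fun ω => (y i ω, x i ω, D i ω))
      (fun ω => (y 0 ω, x 0 ω, D 0 ω)) P P)
    (hgram : (Matrix.of fun j k : Fin p => ∫ ω, x 0 ω j * x 0 ω k ∂P).PosDef)
    (hΨ : IsCompact Ψ) (hΨpos : ∀ ψ ∈ Ψ, 0 < ψ.2) (hψstar : ψstar ∈ Ψ) (hγ : 0 ≤ γ)
    (hc : 0 < γ → IsScaledNormaliser c γ) :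
    ∀ᵐ ω ∂P, ∀ u : ℕ → Vec p × ℝ,
      (∀ n, u n ∈ Ψ ∧ IsMaxOn (objective c y x D n γ ω) Ψ (u n)) →
      Tendsto (fun n : ℕ => (n : ℝ)⁻¹ * totalVar c y x D n γ ω (u n)) atTop
        (𝓝 (∫ ω, robustVar c γ ψstar (y 0 ω) (x 0 ω) (D 0 ω) ∂P)) := by
  have := isCompact_iff_compactSpace.1 hΨ
  have hpos (ψ : Ψ) : 0 < ψ.1.2 := hΨpos ψ ψ.2
  obtain ⟨Q, hQ, hQint⟩ := h.exists_continuousMap_gammaLik hγ hc continuous_subtype_val hpos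
  obtain ⟨V, hV, hVint⟩ := h.exists_continuousMap_robustVar hγ hc continuous_subtype_val hpos
  have hDL : ∀ᵐ ω ∂P, ∀ i, DL ≤ D i ω :=
    (h.ae_forall_mem_Icc hident).mono fun ω hω i => (hω i).1
  have hargmax (ψ : Ψ) (hne : ψ ≠ ⟨ψstar, hψstar⟩) :
      ∫ ω, Q (y 0 ω, x 0 ω, D 0 ω) ψ ∂P
        < ∫ ω, Q (y 0 ω, x 0 ω, D 0 ω) ⟨ψstar, hψstar⟩ ∂P := by
    rw [integral_congr_ae (hDL.mono fun ω hω => hQ (y 0 ω) (x 0 ω, D 0 ω) _ (hω 0)),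
      integral_congr_ae (hDL.mono fun ω hω => hQ (y 0 ω) (x 0 ω, D 0 ω) _ (hω 0))]
    exact h.integral_gammaLik_lt hgram hγ hc (hpos ψ) (hΨpos _ hψstar)
      fun heq => hne (Subtype.ext heq)
  rw [← integral_congr_ae (hDL.mono fun ω hω =>
    hV (y 0 ω) (x 0 ω, D 0 ω) ⟨ψstar, hψstar⟩ (hω 0))]
  filter_upwards [hDL, ae_tendsto_average_at_argmax hindep hident Q V hQint hVint hargmax]
    with ω hω hlim u hu
  have hobjective (n : ℕ) (ψ : Ψ) : ∑ i ∈ Finset.range n, Q (y i ω, x i ω, D i ω) ψ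
      = objective c y x D n γ ω ψ := Finset.sum_congr rfl fun i _ => hQ _ _ ψ (hω i)
  have htotal (n : ℕ) (ψ : Ψ) : ∑ i ∈ Finset.range n, V (y i ω, x i ω, D i ω) ψ
      = totalVar c y x D n γ ω ψ := Finset.sum_congr rfl fun i _ => hV _ _ ψ (hω i)
  simpa only [htotal] using hlim (fun n => ⟨u n, (hu n).1⟩) fun n ψ => by
    rw [hobjective, hobjective]
    exact (hu n).2 ψ.2

end Sample

end FayHerriot

theorem theorem1_general {Ω : Type*} [MeasurableSpace Ω] {P : Measure Ω} [IsProbabilityMeasure P]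
    {p : ℕ} {y : ℕ → Ω → ℝ} {x : ℕ → Ω → FayHerriot.Vec p} {D : ℕ → Ω → ℝ}
    {ψstar : FayHerriot.Vec p × ℝ} {Ψ : Set (FayHerriot.Vec p × ℝ)} {DL DU : ℝ}
    (hmodel : FayHerriot.MarginalModel P (y 0) (x 0) (D 0) ψstar DL DU)
    (hindep : Pairwise fun i j => IndepFun (fun ω => (y i ω, x i ω, D i ω))
      (fun ω => (y j ω, x j ω, D j ω)) P)
    (hident : ∀ i, IdentDistrib (fun ω => (y i ω, x i ω, D i ω))
      (fun ω => (y 0 ω, x 0 ω, D 0 ω)) P P)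
    (hgram : (Matrix.of fun j k : Fin p => ∫ ω, x 0 ω j * x 0 ω k ∂P).PosDef)
    (hΨ : FayHerriot.ParameterCondition Ψ ψstar DL)
    {Γ : Finset ℝ} (hzero : 0 ∈ Γ) (hnonneg : ∀ γ ∈ Γ, 0 ≤ γ)
    {c : ℝ → ℝ → ℝ → ℝ} (hc : ∀ γ ∈ Γ, 0 < γ → FayHerriot.IsScaledNormaliser c γ)
    {ψhat : ℕ → ℝ → Ω → FayHerriot.Vec p × ℝ}
    (hψhat : FayHerriot.IsRobustEstimator P c y x D Ψ Γ ψhat)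
    {γop : ℕ → Ω → ℝ} (hγop : FayHerriot.IsSelected P c y x D Γ ψhat γop) :
    ∀ᵐ ω ∂P, ∀ᶠ m in atTop, γop m ω = 0 ∧ ∀ i,
      FayHerriot.robustMean c (γop m ω) (ψhat m (γop m ω) ω) (y i ω) (x i ω) (D i ω)
        = FayHerriot.bayesMean (ψhat m 0 ω) (y i ω) (x i ω) (D i ω) ∧
      FayHerriot.robustVar c (γop m ω) (ψhat m (γop m ω) ω) (y i ω) (x i ω) (D i ω)
        = FayHerriot.bayesVar (ψhat m 0 ω).2 (D i ω) := by
  have hmax : ∀ᵐ ω ∂P, ∀ γ ∈ Γ, ∀ m, ψhat m γ ω ∈ Ψ ∧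
      IsMaxOn (FayHerriot.objective c y x D m γ ω) Ψ (ψhat m γ ω) :=
    (ae_ball_iff Γ.countable_toSet).2 fun γ hγ => ae_all_iff.2 fun m => hψhat m γ hγ
  have hlim := (ae_ball_iff Γ.countable_toSet).2 fun γ hγ =>
    FayHerriot.ae_tendsto_average_totalVar hmodel hindep hident hgram hΨ.compact hΨ.pos hΨ.true_mem
      (hnonneg γ hγ) (hc γ hγ)
  filter_upwards [hmax, hlim, hmodel.ae_forall_mem_Icc hident, ae_all_iff.2 hγop]
    with ω hmaxω hlimω hDω hop
  have hselected : ∀ᶠ m in atTop, γop m ω = 0 :=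
    FayHerriot.eventually_argmin_eq
      (T := fun (m : ℕ) γ => (m : ℝ)⁻¹ * FayHerriot.totalVar c y x D m γ ω (ψhat m γ ω)) hzero
      (fun γ hγ => hlimω γ hγ _ (hmaxω γ hγ))
      (fun γ hγ hne => hmodel.integral_robustVar_zero_lt ((hnonneg γ hγ).lt_of_ne' hne)
        (hc γ hγ ((hnonneg γ hγ).lt_of_ne' hne)) (hΨ.pos _ hΨ.true_mem) hΨ.lower)
      (fun m => (hop m).1)
      fun m => (hop m).2.comp_mono (monotone_mul_left_of_nonneg (inv_nonneg.2 m.cast_nonneg))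
  filter_upwards [hselected] with m hm
  refine ⟨hm, fun i => ?_⟩
  have hv := add_pos (hΨ.pos _ (hmaxω 0 hzero m).1) (hmodel.DL_pos.trans_le (hDω i).1)
  rw [hm]
  exact ⟨FayHerriot.robustMean_zero c hv _ _, FayHerriot.robustVar_zero c hv _ _⟩

theorem theorem1 {Ω : Type*} [MeasurableSpace Ω] (P : Measure Ω) [IsProbabilityMeasure P]
    {p : ℕ} (θ y : ℕ → Ω → ℝ) (x : ℕ → Ω → FayHerriot.Vec p) (D : ℕ → Ω → ℝ)
    (ψstar : FayHerriot.Vec p × ℝ) (Ψ : Set (FayHerriot.Vec p × ℝ)) (DL DU : ℝ)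
    (hmodel : FayHerriot.CorrectlySpecified P θ y x D ψstar)
    (h1 : FayHerriot.SamplingCondition P y x D DL DU)
    (h2 : FayHerriot.CovariateCondition P x)
    (h3 : FayHerriot.ParameterCondition Ψ ψstar DL)
    (Γ : Finset ℝ) (hΓ : FayHerriot.IsGrid Γ)
    (c : ℝ → ℝ → ℝ → ℝ)
    (hc : c = FayHerriot.integralNormaliser ∨ c = FayHerriot.closedNormaliser)
    (ψhat : ℕ → ℝ → Ω → FayHerriot.Vec p × ℝ)
    (hψhat : FayHerriot.IsRobustEstimator P c y x D Ψ Γ ψhat)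
    (γop : ℕ → Ω → ℝ) (hγop : FayHerriot.IsSelected P c y x D Γ ψhat γop) :
    Tendsto (fun m => P {ω | γop m ω = 0}) atTop (𝓝 1) ∧
    Tendsto (fun m => P {ω | ∀ i < m,
      FayHerriot.robustMean c (γop m ω) (ψhat m (γop m ω) ω) (y i ω) (x i ω) (D i ω)
        = FayHerriot.bayesMean (ψhat m 0 ω) (y i ω) (x i ω) (D i ω) ∧
      FayHerriot.robustVar c (γop m ω) (ψhat m (γop m ω) ω) (y i ω) (x i ω) (D i ω)
        = FayHerriot.bayesVar (ψhat m 0 ω).2 (D i ω)}) atTop (𝓝 1) := by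
  have hnormaliser (γ : ℝ) (hγ : 0 < γ) : FayHerriot.IsScaledNormaliser c γ := by
    rcases hc with rfl | rfl
    · exact FayHerriot.isScaledNormaliser_integralNormaliser (by linarith)
    · exact FayHerriot.isScaledNormaliser_closedNormaliser hγ.le
  have hselected := theorem1_general (hmodel.marginalModel h1 h2 0)
    (fun i j hij => h1.indep.indepFun hij) h1.ident (h2.posDef 0) h3 hΓ.zero_mem
    (fun γ hγ => (hΓ.subset γ hγ).1) (fun γ _ => hnormaliser γ) hψhat hγop
  simp only [← measure_univ (μ := P)]
  exact ⟨FayHerriot.tendsto_measure_of_ae_eventually <|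
      hselected.mono fun ω hω => hω.mono fun m hm => hm.1,
    FayHerriot.tendsto_measure_of_ae_eventually <|
      hselected.mono fun ω hω => hω.mono fun m hm i _ => hm.2 i⟩
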